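/- **Metric structures.** A language $L$ consists of predicate symbols and function symbols with arities, including a distinguished binary predicate symbol $d$. An $L$-structure is a complete metric space $M$ with a continuous map $P^M\colon M^n\to\mathbb{R}$ for each $n$-ary predicate symbol $P$ and a continuous map $f^M\colon M^n\to M$ for each $n$-ary function symbol $f$, where $d^M$ is the distance. An embedding is a map that commutes with the interpretations of all symbols. A tuple $\vec a\in M^n$ generates $M$ if the smallest closed subset of $M$ containing $\vec a$ and closed under all $f^M$ is $M$. **Fraïssé classes.** Let $\mathscr{K}$ be a class of finitely generated $L$-structures. It satisfies * *JEP* if any $A,B\in\mathscr{K}$ embed in a common $C\in\mathscr{K}$; * *NAP* if for all $A,B_1,B_2\in\mathscr{K}$, all embeddings $\varphi_i\colon A\to B_i$ $(i=1,2)$, all finite $G\subseteq A$ and all $\varepsilon>0$ there are $C\in\mathscr{K}$ and embeddings $\psi_i\colon B_i\to C$ with $d(\psi_1\varphi_1(a),\psi_2\varphi_2(a))<\varepsilon$ for all $a\in G$. Let $\mathscr{K}_n$ be the class of pairs $(A,\vec a)$ with $A\in\mathscr{K}$ and $\vec a\in A^n$ generating $A$. If JEP and NAP hold, then $$d^{\mathscr{K}}\bigl((A,\vec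 a),(B,\vec b)\bigr)=\inf\ \max_i d(f(a_i),g(b_i)),$$ the infimum being over all embeddings $f,g$ of $A,B$ into some $C\in\mathscr{K}$, is a pseudometric on $\mathscr{K}_n$. The class $\mathscr{K}$ satisfies * *WPP* if $\mathscr{K}_n$ is separable with respect to $d^{\mathscr{K}}$ for every $n$; * *CCP* if for every $n$-ary predicate symbol $P$ and every $m$ the map $(A,(\vec a,\vec b))\mapsto P^A(\vec a)$ from $\mathscr{K}_{n+m}$ to $\mathbb{R}$, and for every $n$-ary function symbol $f$ and every $m$ the map $(A,(\vec a,\vec b))\mapsto(A,(\vec a,\vec b,f^A(\vec a)))$ from $\mathscr{K}_{n+m}$ to $\mathscr{K}_{n+m+1}$, send Cauchy sequences to Cauchy sequences. A class of finitely generated $L$-structures with JEP, NAP, WPP and CCP is called a *Fraïssé class*. **$C^*$-algebras with traces.** A trace on a unital $C^*$-algebra $A$ is a tracial state: a bounded linear functional $\tau$ with $\tau(1)=1$, $\tau(a^*a)\ge 0$ and $\tau(ab)=\tau(ba)$. It is faithful if $\tau(a^*a)=0$ implies $a=0$. A unital $C^*$-algebra with a trace is regarded as a metric structure in the language with function symbols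 $0$, $1$, $*$, $+$, $\cdot$ and multiplication by $\lambda$ for each $\lambda\in\mathbb{C}$, and with predicate symbols for the distance $\|a-b\|$ and for the (real and imaginary parts of the) trace. Thus the embeddings are the injective unital trace-preserving $*$-homomorphisms. **The class $\mathscr{K}(\nu)$.** A supernatural number is a formal product $\nu=\prod_p p^{n_p}$ over all primes $p$, with $n_p\in\{0,1,2,\dots,\infty\}$ and $\sum_p n_p=\infty$. An integer $n\ge 1$ divides $\nu$ if for every prime $p$ the exponent of $p$ in $n$ is at most $n_p$. Let $\mathscr{K}(\nu)$ be the class of all pairs $\langle C([0,1],\mathbb{M}_n),\tau\rangle$, where $n\ge1$ divides $\nu$, $\mathbb{M}_n$ is the $C^*$-algebra of complex $n\times n$ matrices, and $\tau$ is a faithful trace on the $C^*$-algebra $C([0,1],\mathbb{M}_n)$. **Theorem.** For every supernatural number $\nu$, the class $\mathscr{K}(\nu)$ is a Fraïssé class. That is, all its members are finitely generated, and it satisfies JEP, NAP, WPP and CCP. -/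

import Mathlib

open scoped Matrix.Norms.L2Operator ComplexOrder

noncomputable section

/-! ### Metric structures -/

/-- A language: predicate symbols and function symbols with arities, together with a distinguished
binary predicate symbol `d`, to be interpreted as the distance. -/
structure MetricLanguage where
  /-- The function symbols of each arity. -/
  Fun : ℕ → Type
  /-- The predicate symbols of each arity. -/
  Pred : ℕ → Type
  /-- The distinguished symbol for the distance. -/
  d : Pred 2

/-- An `L`-structure: a complete metric space with continuous interpretations of the symbols,
where `d` is interpreted as the distance function. -/
structure MetricStructure (L : MetricLanguage) where
  /-- The underlying set. -/
  carrier : Type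
  [metricSpace : MetricSpace carrier]
  [completeSpace : CompleteSpace carrier]
  /-- The interpretation of the function symbols. -/
  funMap : ∀ {n : ℕ}, L.Fun n → (Fin n → carrier) → carrier
  /-- The interpretation of the predicate symbols. -/
  predMap : ∀ {n : ℕ}, L.Pred n → (Fin n → carrier) → ℝ
  continuous_funMap : ∀ {n : ℕ} (f : L.Fun n), Continuous (funMap f)
  continuous_predMap : ∀ {n : ℕ} (P : L.Pred n), Continuous (predMap P)
  predMap_d : ∀ x : Fin 2 → carrier, predMap L.d x = dist (x 0) (x 1)

namespace MetricStructure

variable {L : MetricLanguage}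

instance : CoeSort (MetricStructure L) Type := ⟨carrier⟩

instance (M : MetricStructure L) : MetricSpace M := M.metricSpace

instance (M : MetricStructure L) : CompleteSpace M := M.completeSpace

/-- An embedding of `L`-structures: a map commuting with the interpretations of all the symbols
(in particular of `d`, so that it is isometric). -/
structure Embedding (M N : MetricStructure L) where
  /-- The underlying map. -/
  toFun : M → N
  map_fun : ∀ {n : ℕ} (f : L.Fun n) (x : Fin n → M),
    N.funMap f (fun i => toFun (x i)) = toFun (M.funMap f x)
  map_pred : ∀ {n : ℕ} (P : L.Pred n) (x : Fin n → M),
    N.predMap P (fun i => toFun (x i)) = M.predMap P x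

instance (M N : MetricStructure L) : CoeFun (Embedding M N) (fun _ => M → N) :=
  ⟨Embedding.toFun⟩

/-- The subset `T` is (the underlying set of) a substructure of `M`: it is closed under the function
symbols and complete, i.e. closed in the complete space `M`. -/
def IsSubstructure (M : MetricStructure L) (T : Set M) : Prop :=
  IsClosed T ∧ ∀ {n : ℕ} (f : L.Fun n) (x : Fin n → M), (∀ i, x i ∈ T) → M.funMap f x ∈ T

/-- The tuple `a` generates `M`: the smallest substructure containing `a` is `M`. -/
def Generates (M : MetricStructure L) {n : ℕ} (a : Fin n → M) : Prop :=
  ∀ T : Set M, M.IsSubstructure T → (∀ i, a i ∈ T) → T = Set.univ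

/-- `M` is finitely generated. -/
def IsFinitelyGenerated (M : MetricStructure L) : Prop :=
  ∃ (n : ℕ) (a : Fin n → M), M.Generates a

lemma Generates.snoc {M : MetricStructure L} {n : ℕ} {a : Fin n → M} (ha : M.Generates a) (b : M) :
    M.Generates (Fin.snoc a b : Fin (n + 1) → M) := by
  intro T hT h
  refine ha T hT fun i => ?_
  simpa using h i.castSucc

end MetricStructure

/-! ### Fraïssé classes -/

namespace MetricStructure

variable {L : MetricLanguage}

/-- The joint embedding property. -/
def JEP (K : Set (MetricStructure L)) : Prop :=
  ∀ A ∈ K, ∀ B ∈ K, ∃ C ∈ K, Nonempty (Embedding A C) ∧ Nonempty (Embedding B C)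

/-- The near amalgamation property. -/
def NAP (K : Set (MetricStructure L)) : Prop :=
  ∀ A ∈ K, ∀ B₁ ∈ K, ∀ B₂ ∈ K, ∀ (φ₁ : Embedding A B₁) (φ₂ : Embedding A B₂) (G : Set A),
    G.Finite → ∀ ε : ℝ, 0 < ε →
      ∃ C ∈ K, ∃ (ψ₁ : Embedding B₁ C) (ψ₂ : Embedding B₂ C),
        ∀ a ∈ G, dist (ψ₁ (φ₁ a)) (ψ₂ (φ₂ a)) < ε

/-- The class `𝒦ₙ` of pairs `(A, a)` with `A` in `𝒦` and `a ∈ Aⁿ` a generator of `A`. -/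
structure Pointed (K : Set (MetricStructure L)) (n : ℕ) where
  /-- The structure. -/
  str : MetricStructure L
  mem : str ∈ K
  /-- The generating tuple. -/
  tup : Fin n → str
  gen : str.Generates tup

/-- The pseudometric on `𝒦ₙ`: the infimum of `maxᵢ d(f(aᵢ), g(bᵢ))` over all embeddings `f`, `g` of
`A`, `B` into a common member of `𝒦`. (The distance of `Fin n → C` is the maximum of the
coordinate distances.) -/
def Pointed.dist {K : Set (MetricStructure L)} {n : ℕ} (x y : Pointed K n) : ℝ :=
  sInf {r : ℝ | ∃ C ∈ K, ∃ (f : Embedding x.str C) (g : Embedding y.str C),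
    r = Dist.dist (fun i => f (x.tup i)) (fun i => g (y.tup i))}

/-- A sequence in `𝒦ₙ` is Cauchy with respect to the pseudometric. -/
def Pointed.IsCauchy {K : Set (MetricStructure L)} {n : ℕ} (x : ℕ → Pointed K n) : Prop :=
  ∀ ε : ℝ, 0 < ε → ∃ N : ℕ, ∀ k ≥ N, ∀ l ≥ N, (x k).dist (x l) < ε

/-- The map `(A, (a, b)) ↦ P^A(a)` from `𝒦ₙ₊ₘ` to `ℝ`, for an `n`-ary predicate symbol `P`. -/
def Pointed.evalPred {K : Set (MetricStructure L)} {n m : ℕ} (P : L.Pred n)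
    (x : Pointed K (n + m)) : ℝ :=
  x.str.predMap P (fun i => x.tup (Fin.castAdd m i))

/-- The map `(A, (a, b)) ↦ (A, (a, b, f^A(a)))` from `𝒦ₙ₊ₘ` to `𝒦ₙ₊ₘ₊₁`, for an `n`-ary function
symbol `f`. -/
def Pointed.adjoinFun {K : Set (MetricStructure L)} {n m : ℕ} (f : L.Fun n)
    (x : Pointed K (n + m)) : Pointed K (n + m + 1) where
  str := x.str
  mem := x.mem
  tup := Fin.snoc x.tup (x.str.funMap f (fun i => x.tup (Fin.castAdd m i)))
  gen := x.gen.snoc _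

/-- The weak Polish property: each `𝒦ₙ` is separable for the pseudometric. -/
def WPP (K : Set (MetricStructure L)) : Prop :=
  ∀ n : ℕ, ∃ D : Set (Pointed K n), D.Countable ∧
    ∀ x : Pointed K n, ∀ ε : ℝ, 0 < ε → ∃ y ∈ D, x.dist y < ε

/-- The Cauchy continuity property. -/
def CCP (K : Set (MetricStructure L)) : Prop :=
  (∀ (n m : ℕ) (P : L.Pred n) (x : ℕ → Pointed K (n + m)), Pointed.IsCauchy x →
    CauchySeq fun k => (x k).evalPred P) ∧
  (∀ (n m : ℕ) (f : L.Fun n) (x : ℕ → Pointed K (n + m)), Pointed.IsCauchy x →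
    Pointed.IsCauchy fun k => (x k).adjoinFun f)

/-- A Fraïssé class: a class of finitely generated structures with JEP, NAP, WPP and CCP. -/
structure IsFraisseClass (K : Set (MetricStructure L)) : Prop where
  finitelyGenerated : ∀ A ∈ K, A.IsFinitelyGenerated
  jep : JEP K
  nap : NAP K
  wpp : WPP K
  ccp : CCP K

end MetricStructure

/-! ### Unital C*-algebras with traces as metric structures -/

/-- The function symbols for unital C*-algebras: `0`, `1`, the involution, multiplication by each
complex scalar, `+` and `·`. -/
inductive TracialFun : ℕ → Type
  | zero : TracialFun 0
  | one : TracialFun 0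
  | star : TracialFun 1
  | smul (c : ℂ) : TracialFun 1
  | add : TracialFun 2
  | mul : TracialFun 2

/-- The predicate symbols: the distance and the trace. As predicates are real-valued, the trace is
recorded by its real and imaginary parts. -/
inductive TracialPred : ℕ → Type
  | dist : TracialPred 2
  | trRe : TracialPred 1
  | trIm : TracialPred 1

/-- The language of unital C*-algebras with a distinguished trace. -/
def tracialLanguage : MetricLanguage where
  Fun := TracialFun
  Pred := TracialPred
  d := TracialPred.dist

/-- A trace, i.e. a tracial state, on a unital C*-algebra. -/
structure TracialState (A : Type) [CStarAlgebra A] where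
  /-- The underlying bounded linear functional. -/
  toCLM : A →L[ℂ] ℂ
  map_one : toCLM 1 = 1
  nonneg : ∀ a : A, 0 ≤ toCLM (star a * a)
  tracial : ∀ a b : A, toCLM (a * b) = toCLM (b * a)

/-- A trace is faithful if `τ(a* a) = 0` only for `a = 0`. -/
def TracialState.IsFaithful {A : Type} [CStarAlgebra A] (τ : TracialState A) : Prop :=
  ∀ a : A, τ.toCLM (star a * a) = 0 → a = 0

/-- The interpretation of the function symbols in a unital C*-algebra. -/
def tracialFunMap (A : Type) [CStarAlgebra A] : ∀ {n : ℕ}, TracialFun n → (Fin n → A) → A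
  | _, .zero, _ => 0
  | _, .one, _ => 1
  | _, .star, x => star (x 0)
  | _, .smul c, x => c • x 0
  | _, .add, x => x 0 + x 1
  | _, .mul, x => x 0 * x 1

/-- The interpretation of the predicate symbols in a unital C*-algebra with a trace. -/
def tracialPredMap {A : Type} [CStarAlgebra A] (τ : TracialState A) :
    ∀ {n : ℕ}, TracialPred n → (Fin n → A) → ℝ
  | _, .dist, x => dist (x 0) (x 1)
  | _, .trRe, x => (τ.toCLM (x 0)).re
  | _, .trIm, x => (τ.toCLM (x 0)).im

lemma continuous_tracialFunMap (A : Type) [CStarAlgebra A] {n : ℕ} (f : TracialFun n) :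
    Continuous (tracialFunMap A f) := by
  cases f <;> unfold tracialFunMap <;> dsimp only <;> fun_prop

lemma continuous_tracialPredMap {A : Type} [CStarAlgebra A] (τ : TracialState A) {n : ℕ}
    (P : TracialPred n) : Continuous (tracialPredMap τ P) := by
  cases P <;> unfold tracialPredMap <;> dsimp only <;> fun_prop

/-- A unital C*-algebra with a distinguished trace, as a metric structure. -/
def TracialState.toMetricStructure {A : Type} [CStarAlgebra A] (τ : TracialState A) :
    MetricStructure tracialLanguage where
  carrier := A
  funMap := tracialFunMap A
  predMap := tracialPredMap τ
  continuous_funMap f := continuous_tracialFunMap A f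
  continuous_predMap P := continuous_tracialPredMap τ P
  predMap_d _ := rfl

/-! ### The class attached to a supernatural number -/

/-- A supernatural number: a formal product of prime powers with exponents in `{0, 1, 2, …, ∞}`
whose sum is infinite. -/
structure SupernaturalNumber where
  /-- The exponent of each prime. -/
  exponent : Nat.Primes → ℕ∞
  sum_eq_top : ⨆ s : Finset Nat.Primes, ∑ p ∈ s, exponent p = ⊤

/-- The natural number `n` formally divides `ν`. -/
def SupernaturalNumber.IsDivisor (ν : SupernaturalNumber) (n : ℕ) : Prop :=
  n ≠ 0 ∧ ∀ p : Nat.Primes, (padicValNat p n : ℕ∞) ≤ ν.exponent p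

/-- The C*-algebra `C([0,1], Mₙ)`, where `Mₙ` carries the C*-norm (the operator norm). -/
abbrev MatrixPath (n : ℕ) : Type := C(unitInterval, Matrix (Fin n) (Fin n) ℂ)

/-- The class of all `⟨C([0,1], Mₙ), τ⟩` with `n` a divisor of `ν` and `τ` a faithful trace. -/
def SupernaturalNumber.matrixPathClass (ν : SupernaturalNumber) :
    Set (MetricStructure tracialLanguage) :=
  {S | ∃ n : ℕ, ν.IsDivisor n ∧ ∃ τ : TracialState (MatrixPath n),
    τ.IsFaithful ∧ S = τ.toMetricStructure}

end

noncomputable section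

open MeasureTheory

/-! ### The normalized matrix trace -/

/-! A trace on `C([0,1], Mₙ)` is determined by its restriction to the center, so by Riesz
representation it is integration of the normalized matrix trace against a probability measure on
`[0,1]`; faithfulness makes the support full. Full support makes the distribution function strictly
increasing, so its generalized inverse, the quantile function, is continuous, and it pushes Lebesgue
measure to the given measure. Composing with it, and repeating diagonally, embeds every member of
the class trace-preservingly into the Lebesgue trace on any multiple size
(`exists_continuousMap_map_volume_eq`, `nonempty_embedding_lebesgueTrace`).

The Lebesgue traces are therefore a countable cofinal family of separable structures. JEP follows by
taking least common multiples of sizes, and WPP by separability. CCP holds because all symbols are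
Lipschitz on bounded sets, with constants valid for the whole class, and Cauchy sequences are
eventually bounded.

NAP is the substantial point (`exists_close_of_trace_preserving`). After enlarging the targets there
are two trace-preserving homomorphisms into the same Lebesgue trace. Following them by `f ↦ diag(f ∘
ξ₁, …, f ∘ ξ_N)`, with `ξⱼ` affine onto the intervals of length `1/N`, preserves the Lebesgue trace
and makes finitely many images nearly constant, hence close to values of a finite-dimensional
representation. Such a representation is unitarily a sum of point evaluations
(`exists_unitary_conj_eq`). Both lists of points have nearly the averages prescribed by the original
trace on finitely many test functions, and full support then forces the sorted lists to be close
term by term (`sub_lt_of_averages_ramp`). Conjugating by the unitary that carries one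
diagonalization to the other brings the two maps together. Sizes with arbitrarily large `N` are
available because the exponents of `ν` have infinite sum. -/

/-- The normalized trace on `n × n` matrices. -/
def ntr (n : ℕ) : Matrix (Fin n) (Fin n) ℂ →ₗ[ℂ] ℂ :=
  (n : ℂ)⁻¹ • Matrix.traceLinearMap (Fin n) ℂ ℂ

lemma ntr_apply (n : ℕ) (A : Matrix (Fin n) (Fin n) ℂ) : ntr n A = (n : ℂ)⁻¹ * A.trace := rfl

lemma ntr_one (n : ℕ) [NeZero n] : ntr n 1 = 1 := by
  simp [ntr_apply]

lemma ntr_mul_comm {n : ℕ} (A B : Matrix (Fin n) (Fin n) ℂ) : ntr n (A * B) = ntr n (B * A) := by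
  rw [ntr_apply, ntr_apply, Matrix.trace_mul_comm]

lemma ntr_star_mul_self_nonneg {n : ℕ} (A : Matrix (Fin n) (Fin n) ℂ) :
    0 ≤ ntr n (star A * A) := by
  rw [ntr_apply]
  refine mul_nonneg (by rw [inv_nonneg]; exact_mod_cast Nat.zero_le n) ?_
  exact (Matrix.posSemidef_conjTranspose_mul_self A).trace_nonneg

lemma ntr_star_mul_self_eq_zero {n : ℕ} [NeZero n] {A : Matrix (Fin n) (Fin n) ℂ}
    (h : ntr n (star A * A) = 0) : A = 0 := by
  rw [ntr_apply, mul_eq_zero] at h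
  rcases h with h | h
  · simp [NeZero.ne n] at h
  · exact Matrix.trace_conjTranspose_mul_self_eq_zero_iff.1 h

lemma norm_matrix_entry_le {n : ℕ} (A : Matrix (Fin n) (Fin n) ℂ) (i j : Fin n) :
    ‖A i j‖ ≤ ‖A‖ := by
  have h := Matrix.l2_opNorm_mulVec A (EuclideanSpace.single j (1 : ℂ))
  have h2 := PiLp.norm_apply_le
    ((EuclideanSpace.equiv (Fin n) ℂ).symm (A.mulVec (EuclideanSpace.single j (1 : ℂ)).ofLp)) i
  simp at h h2
  exact h2.trans h

lemma norm_ntr_le {n : ℕ} (A : Matrix (Fin n) (Fin n) ℂ) : ‖ntr n A‖ ≤ ‖A‖ := by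
  rcases Nat.eq_zero_or_pos n with rfl | hn
  · simp [ntr_apply]
  rw [ntr_apply, norm_mul, norm_inv, Complex.norm_natCast, inv_mul_le_iff₀ (by positivity)]
  calc ‖A.trace‖ ≤ ∑ i : Fin n, ‖A i i‖ := norm_sum_le _ _
    _ ≤ ∑ _i : Fin n, ‖A‖ := Finset.sum_le_sum fun i _ => norm_matrix_entry_le A i i
    _ = n * ‖A‖ := by simp

lemma continuous_ntr (n : ℕ) : Continuous (ntr n) :=
  (ntr n).continuous_of_finiteDimensional

/-! ### The Lebesgue trace -/

instance : Measure.IsOpenPosMeasure (volume : Measure unitInterval) where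
  open_pos U hU hne := by
    obtain ⟨x, hx⟩ := hne
    obtain ⟨a, b, hab, h⟩ := hU.exists_Ioo_subset ⟨x, hx⟩
    refine (lt_of_lt_of_le ?_ (measure_mono h)).ne'
    simpa using hab

lemma integrable_continuous {E : Type*} [NormedAddCommGroup E]
    {f : unitInterval → E} (hf : Continuous f) : Integrable f :=
  hf.integrable_of_hasCompactSupport (HasCompactSupport.of_compactSpace f)

/-- The trace on `C([0,1], Mₙ)` obtained by integrating the normalized trace. -/
def lebesgueTrace (n : ℕ) [NeZero n] : TracialState (MatrixPath n) where
  toCLM := LinearMap.mkContinuous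
    { toFun := fun a => ∫ t, ntr n (a t)
      map_add' := fun a b => by
        simp only [ContinuousMap.add_apply, map_add]
        exact integral_add (integrable_continuous ((continuous_ntr n).comp a.continuous))
          (integrable_continuous ((continuous_ntr n).comp b.continuous))
      map_smul' := fun c a => by
        simp only [ContinuousMap.smul_apply, map_smul, RingHom.id_apply]
        exact integral_smul _ _ } 1 fun a => by
      refine (norm_integral_le_of_norm_le_const (C := ‖a‖) (.of_forall fun t => ?_)).trans ?_
      · exact (norm_ntr_le _).trans (a.norm_coe_le_norm t)
      · simp
  map_one := by
    change ∫ t, ntr n ((1 : MatrixPath n) t) = 1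
    simp [ntr_one]
  nonneg a := by
    change 0 ≤ ∫ t, ntr n ((star a * a) t)
    exact integral_nonneg fun t => ntr_star_mul_self_nonneg (a t)
  tracial a b := by
    change ∫ t, ntr n ((a * b) t) = ∫ t, ntr n ((b * a) t)
    simp only [ContinuousMap.mul_apply, ntr_mul_comm (a _)]

lemma lebesgueTrace_apply {n : ℕ} [NeZero n] (a : MatrixPath n) :
    (lebesgueTrace n).toCLM a = ∫ t, ntr n (a t) := rfl

lemma norm_lebesgueTrace_le {n : ℕ} [NeZero n] (a : MatrixPath n) :
    ‖(lebesgueTrace n).toCLM a‖ ≤ ‖a‖ := by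
  rw [lebesgueTrace_apply]
  refine (norm_integral_le_of_norm_le_const (C := ‖a‖) (.of_forall fun t => ?_)).trans ?_
  · exact (norm_ntr_le _).trans (a.norm_coe_le_norm t)
  · simp

/-- A nonnegative continuous function with zero integral vanishes almost everywhere, hence
everywhere, since Lebesgue measure charges nonempty open sets. -/
lemma lebesgueTrace_isFaithful (n : ℕ) [NeZero n] : (lebesgueTrace n).IsFaithful := by
  intro a ha
  rw [lebesgueTrace_apply] at ha
  have hc : Continuous fun t => ntr n ((star a * a) t) :=
    (continuous_ntr n).comp (star a * a).continuous
  have hre : ∀ t, 0 ≤ (ntr n ((star a * a) t)).re := fun t =>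
    (Complex.le_def.1 (ntr_star_mul_self_nonneg (a t))).1
  have h0 : ∫ t, (ntr n ((star a * a) t)).re = 0 := by
    have := integral_re (integrable_continuous hc) (𝕜 := ℂ)
    simp only [RCLike.re_eq_complex_re] at this
    rw [this, ha, Complex.zero_re]
  have h1 := (integral_eq_zero_iff_of_nonneg hre
    (integrable_continuous (Complex.continuous_re.comp hc))).1 h0
  have h2 := Continuous.ae_eq_iff_eq (volume : Measure unitInterval)
    (Complex.continuous_re.comp hc) continuous_zero |>.1 h1
  ext1 t
  refine ntr_star_mul_self_eq_zero (Complex.ext (congrFun h2 t) ?_)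
  exact (Complex.le_def.1 (ntr_star_mul_self_nonneg (a t))).2.symm

/-! ### Generators of `C([0,1], Mₙ)` -/

/-- A constant path of matrices. -/
abbrev constPath {n : ℕ} (A : Matrix (Fin n) (Fin n) ℂ) : MatrixPath n := ContinuousMap.const _ A

/-- The embedding of `C([0,1])` as the center of `C([0,1], Mₙ)`. -/
def scalarPath (n : ℕ) : C(unitInterval, ℂ) →⋆ₐ[ℂ] MatrixPath n where
  toFun g := ⟨fun t => g t • 1, by fun_prop⟩
  map_one' := by ext1 t; simp
  map_mul' g h := by ext1 t; simp [smul_smul, mul_comm]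
  map_zero' := by ext1 t; simp
  map_add' g h := by ext1 t; simp [add_smul]
  commutes' c := by ext1 t; simp [Algebra.algebraMap_eq_smul_one]
  map_star' g := by ext1 t; simp

@[simp] lemma scalarPath_apply (n : ℕ) (g : C(unitInterval, ℂ)) (t : unitInterval) :
    scalarPath n g t = g t • 1 := rfl

lemma continuous_scalarPath (n : ℕ) : Continuous (scalarPath n) :=
  AddMonoidHomClass.continuous_of_bound (scalarPath n) 1 fun g => by
    simpa using NonUnitalStarAlgHom.norm_apply_le (scalarPath n) g

/-- The inclusion of `[0,1]` in `ℂ`. -/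
def coordinate : C(unitInterval, ℂ) := ⟨fun t => ((t : ℝ) : ℂ), by fun_prop⟩

@[simp] lemma coordinate_apply (t : unitInterval) : coordinate t = ((t : ℝ) : ℂ) := rfl

lemma matrixPath_eq_sum {n : ℕ} (a : MatrixPath n) :
    a = ∑ i, ∑ j, scalarPath n ⟨fun t => a t i j, by fun_prop⟩ *
      constPath (Matrix.single i j 1) := by
  ext1 t
  simp only [ContinuousMap.coe_sum, Finset.sum_apply, ContinuousMap.mul_apply, scalarPath_apply,
    ContinuousMap.coe_mk, ContinuousMap.const_apply, smul_mul_assoc, one_mul]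
  conv_lhs => rw [Matrix.matrix_eq_sum_single (a t)]
  simp [Matrix.smul_single]

/-- A closed star subalgebra of `C([0,1], Mₙ)` containing the constant matrix units and the
coordinate function is everything. -/
lemma starSubalgebra_matrixPath_eq_top {n : ℕ} (S : StarSubalgebra ℂ (MatrixPath n))
    (hS : IsClosed (S : Set (MatrixPath n))) (h1 : scalarPath n coordinate ∈ S)
    (h2 : ∀ i j, constPath (Matrix.single i j 1) ∈ S) : S = ⊤ := by
  -- Stone–Weierstrass on the center: the coordinate function alone separates points.
  have h3 : S.comap (scalarPath n) = ⊤ := by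
    rw [← ContinuousMap.starSubalgebra_topologicalClosure_eq_top_of_separatesPoints
      (S.comap (scalarPath n))]
    · refine le_antisymm (StarSubalgebra.le_topologicalClosure _) ?_
      exact StarSubalgebra.topologicalClosure_minimal le_rfl
        (hS.preimage (continuous_scalarPath n))
    · intro s t hst
      refine ⟨_, ⟨coordinate, h1, rfl⟩, ?_⟩
      simpa [Subtype.ext_iff] using hst
  refine eq_top_iff.2 fun a _ => ?_
  rw [matrixPath_eq_sum a]
  refine sum_mem fun i _ => sum_mem fun j _ => mul_mem ?_ (h2 i j)
  have : (⟨fun t => a t i j, by fun_prop⟩ : C(unitInterval, ℂ)) ∈ S.comap (scalarPath n) := by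
    rw [h3]; trivial
  exact this

/-- Two star homomorphisms that agree on the matrix units and on the coordinate
function are equal. -/
lemma matrixPath_starAlgHom_ext {n : ℕ} {B : Type*} [CStarAlgebra B]
    {φ ψ : MatrixPath n →⋆ₐ[ℂ] B} (h1 : φ (scalarPath n coordinate) = ψ (scalarPath n coordinate))
    (h2 : ∀ i j, φ (constPath (Matrix.single i j 1)) = ψ (constPath (Matrix.single i j 1))) :
    φ = ψ := by
  have hc : ∀ χ : MatrixPath n →⋆ₐ[ℂ] B, Continuous χ := fun χ =>
    AddMonoidHomClass.continuous_of_bound χ 1 fun a => by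
      simpa using NonUnitalStarAlgHom.norm_apply_le χ a
  have h := starSubalgebra_matrixPath_eq_top (StarAlgHom.equalizer φ ψ)
    (isClosed_eq (hc φ) (hc ψ)) h1 h2
  ext1 a
  have : a ∈ StarAlgHom.equalizer φ ψ := by rw [h]; trivial
  exact this

/-- The `n² + 1` generators are the constant matrix units and the coordinate function (indexed by
`none`); a substructure is exactly a closed unital star subalgebra. -/
lemma isFinitelyGenerated_matrixPath {n : ℕ} (τ : TracialState (MatrixPath n)) :
    τ.toMetricStructure.IsFinitelyGenerated := by
  let e := Fintype.equivFin (Option (Fin n × Fin n))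
  let g : Option (Fin n × Fin n) → MatrixPath n := fun o =>
    o.elim (scalarPath n coordinate) fun p => constPath (Matrix.single p.1 p.2 1)
  refine ⟨_, fun i => g (e.symm i), fun T hT hg => ?_⟩
  obtain ⟨hTc, hTf⟩ := hT
  have hmem : ∀ o, g o ∈ T := fun o => by
    have h : g (e.symm (e o)) ∈ T := hg (e o)
    rwa [e.symm_apply_apply] at h
  have hz : (0 : MatrixPath n) ∈ T := hTf TracialFun.zero ![] (by simp)
  have ho : (1 : MatrixPath n) ∈ T := hTf TracialFun.one ![] (by simp)
  have hs : ∀ c : ℂ, ∀ a : MatrixPath n, a ∈ T → c • a ∈ T := fun c a ha =>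
    hTf (TracialFun.smul c) ![a] fun i => by fin_cases i; exact ha
  let S : StarSubalgebra ℂ (MatrixPath n) :=
    { carrier := T
      zero_mem' := hz
      one_mem' := ho
      add_mem' := fun {a b} ha hb => hTf TracialFun.add ![a, b] (by
        intro i; fin_cases i <;> assumption)
      mul_mem' := fun {a b} ha hb => hTf TracialFun.mul ![a, b] (by
        intro i; fin_cases i <;> assumption)
      star_mem' := fun {a} ha => hTf TracialFun.star ![a] fun i => by fin_cases i; exact ha
      algebraMap_mem' := fun c => by
        rw [Algebra.algebraMap_eq_smul_one]; exact hs c 1 ho }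
  have hS : S = ⊤ := starSubalgebra_matrixPath_eq_top S hTc (hmem none)
    fun i j => hmem (some (i, j))
  exact congrArg (fun S : StarSubalgebra ℂ (MatrixPath n) => (S : Set (MatrixPath n))) hS

/-! ### Embeddings and star homomorphisms -/

/-- A trace-preserving star homomorphism is an embedding if the first trace is faithful. -/
def StarAlgHom.toTracialEmbedding {A B : Type} [CStarAlgebra A] [CStarAlgebra B]
    {σ : TracialState A} {τ : TracialState B} (φ : A →⋆ₐ[ℂ] B) (hσ : σ.IsFaithful)
    (h : ∀ a, τ.toCLM (φ a) = σ.toCLM a) :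
    MetricStructure.Embedding σ.toMetricStructure τ.toMetricStructure where
  toFun := φ
  map_fun f x := by
    have key : ∀ x : Fin _ → A, tracialFunMap B f (fun i => φ (x i)) = φ (tracialFunMap A f x) := by
      intro x
      cases f <;> simp [tracialFunMap, map_star]
    exact key x
  map_pred P x := by
    -- Faithfulness gives injectivity, and injective star homomorphisms of C*-algebras are
    -- isometric, which handles the distance symbol.
    have hinj : Function.Injective φ := by
      refine (injective_iff_map_eq_zero φ).2 fun a ha => hσ a ?_
      rw [← h, map_mul, ha, mul_zero, map_zero]
    have key : ∀ x : Fin _ → A, tracialPredMap τ P (fun i => φ (x i)) = tracialPredMap σ P x := by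
      intro x
      cases P
      · simp only [tracialPredMap]
        rw [dist_eq_norm, dist_eq_norm, ← map_sub]
        exact NonUnitalStarAlgHom.norm_map φ hinj _
      · simp only [tracialPredMap, h]
      · simp only [tracialPredMap, h]
    exact key x

/-- The star homomorphism underlying an embedding. -/
def MetricStructure.Embedding.toStarAlgHom {A B : Type} [CStarAlgebra A] [CStarAlgebra B]
    {σ : TracialState A} {τ : TracialState B}
    (φ : MetricStructure.Embedding σ.toMetricStructure τ.toMetricStructure) : A →⋆ₐ[ℂ] B where
  toFun := φ.toFun
  map_one' := (φ.map_fun TracialFun.one ![]).symm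
  map_zero' := (φ.map_fun TracialFun.zero ![]).symm
  map_add' a b := (φ.map_fun TracialFun.add ![a, b]).symm
  map_mul' a b := (φ.map_fun TracialFun.mul ![a, b]).symm
  map_star' a := (φ.map_fun TracialFun.star ![a]).symm
  commutes' c := by
    have h1 : (1 : B) = φ.toFun (1 : A) := φ.map_fun TracialFun.one ![]
    rw [Algebra.algebraMap_eq_smul_one, Algebra.algebraMap_eq_smul_one, h1]
    exact (φ.map_fun (TracialFun.smul c) ![(1 : A)]).symm

lemma MetricStructure.Embedding.trace_toStarAlgHom {A B : Type} [CStarAlgebra A] [CStarAlgebra B]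
    {σ : TracialState A} {τ : TracialState B}
    (φ : MetricStructure.Embedding σ.toMetricStructure τ.toMetricStructure) (a : A) :
    τ.toCLM (φ.toStarAlgHom a) = σ.toCLM a :=
  Complex.ext (φ.map_pred TracialPred.trRe ![a]) (φ.map_pred TracialPred.trIm ![a])

/-- The composition of embeddings. -/
def MetricStructure.Embedding.comp {L : MetricLanguage} {M N P : MetricStructure L}
    (g : MetricStructure.Embedding N P) (f : MetricStructure.Embedding M N) :
    MetricStructure.Embedding M P where
  toFun x := g (f x)
  map_fun F x := by rw [g.map_fun, f.map_fun]
  map_pred R x := by rw [g.map_pred, f.map_pred]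

lemma MetricStructure.Embedding.dist_map {L : MetricLanguage} {M N : MetricStructure L}
    (f : MetricStructure.Embedding M N) (x y : M) : dist (f x) (f y) = dist x y := by
  have := f.map_pred L.d ![x, y]
  rwa [N.predMap_d, M.predMap_d] at this

/-! ### Block diagonal homomorphisms -/

/-- Block diagonal matrices with `N` blocks of size `m`, as matrices of size `M`. -/
def blockHom {m N M : ℕ} (e : Fin m × Fin N ≃ Fin M) :
    (Fin N → Matrix (Fin m) (Fin m) ℂ) →⋆ₐ[ℂ] Matrix (Fin M) (Fin M) ℂ where
  toFun B := (Matrix.blockDiagonal B).submatrix e.symm e.symm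
  map_one' := by simp
  map_mul' B C := by
    rw [Matrix.submatrix_mul_equiv, ← Matrix.blockDiagonal_mul]
    rfl
  map_zero' := by simp
  map_add' B C := by simp [Matrix.submatrix_add]
  commutes' c := by
    simp only [Algebra.algebraMap_eq_smul_one, Matrix.blockDiagonal_smul, Matrix.blockDiagonal_one,
      Matrix.submatrix_smul]
    simp
  map_star' B := by
    simp only [Matrix.star_eq_conjTranspose, Matrix.conjTranspose_submatrix,
      Matrix.blockDiagonal_conjTranspose]
    rfl

lemma blockHom_apply {m N M : ℕ} (e : Fin m × Fin N ≃ Fin M)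
    (B : Fin N → Matrix (Fin m) (Fin m) ℂ) (p q : Fin M) :
    blockHom e B p q = Matrix.blockDiagonal B (e.symm p) (e.symm q) := rfl

lemma continuous_blockHom {m N M : ℕ} (e : Fin m × Fin N ≃ Fin M) : Continuous (blockHom e) := by
  change Continuous fun B : Fin N → Matrix (Fin m) (Fin m) ℂ =>
    (Matrix.blockDiagonal B).submatrix e.symm e.symm
  fun_prop

lemma norm_blockHom_le {m N M : ℕ} (e : Fin m × Fin N ≃ Fin M)
    {B : Fin N → Matrix (Fin m) (Fin m) ℂ} {c : ℝ} (hc : 0 ≤ c) (h : ∀ j, ‖B j‖ ≤ c) :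
    ‖blockHom e B‖ ≤ c :=
  (NonUnitalStarAlgHom.norm_apply_le (blockHom e) B).trans ((pi_norm_le_iff_of_nonneg hc).2 h)

lemma ntr_blockHom {m N M : ℕ} (e : Fin m × Fin N ≃ Fin M)
    (B : Fin N → Matrix (Fin m) (Fin m) ℂ) :
    ntr M (blockHom e B) = (N : ℂ)⁻¹ * ∑ j, ntr m (B j) := by
  have hM : M = m * N := by simpa using (Fintype.card_congr e).symm
  have h1 : (blockHom e B).trace = (Matrix.blockDiagonal B).trace := by
    simp only [Matrix.trace, Matrix.diag_apply, blockHom_apply]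
    exact e.symm.sum_comp fun p => Matrix.blockDiagonal B p p
  simp only [ntr_apply]
  rw [h1, Matrix.trace_blockDiagonal, ← Finset.mul_sum, hM]
  push_cast
  rw [mul_inv]
  ring

/-- The star homomorphism `f ↦ diag(f ∘ ξ₁, …, f ∘ ξ_N)`. -/
def pathHom {m N M : ℕ} (e : Fin m × Fin N ≃ Fin M) (ξ : Fin N → C(unitInterval, unitInterval)) :
    MatrixPath m →⋆ₐ[ℂ] MatrixPath M where
  toFun a := ⟨fun t => blockHom e fun j => a (ξ j t), by
    refine (continuous_blockHom e).comp ?_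
    fun_prop⟩
  map_one' := by ext1 t; exact map_one (blockHom e)
  map_mul' a b := by ext1 t; exact map_mul (blockHom e) _ _
  map_zero' := by ext1 t; exact map_zero (blockHom e)
  map_add' a b := by ext1 t; exact map_add (blockHom e) _ _
  commutes' c := by ext1 t; exact AlgHomClass.commutes (blockHom e) c
  map_star' a := by ext1 t; exact map_star (blockHom e) _

lemma pathHom_apply {m N M : ℕ} (e : Fin m × Fin N ≃ Fin M)
    (ξ : Fin N → C(unitInterval, unitInterval)) (a : MatrixPath m) (t : unitInterval) :
    pathHom e ξ a t = blockHom e fun j => a (ξ j t) := rfl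

lemma lebesgueTrace_pathHom {m N M : ℕ} [NeZero M] (e : Fin m × Fin N ≃ Fin M)
    (ξ : Fin N → C(unitInterval, unitInterval)) (a : MatrixPath m) :
    (lebesgueTrace M).toCLM (pathHom e ξ a) = (N : ℂ)⁻¹ * ∑ j, ∫ t, ntr m (a (ξ j t)) := by
  rw [lebesgueTrace_apply]
  simp only [pathHom_apply, ntr_blockHom]
  rw [integral_const_mul, integral_finsetSum]
  exact fun j _ => integrable_continuous
    ((continuous_ntr m).comp (a.continuous.comp (ξ j).continuous))

/-! ### Divisors of a supernatural number -/

namespace SupernaturalNumber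

variable {ν : SupernaturalNumber}

lemma IsDivisor.lcm {m n : ℕ} (hm : ν.IsDivisor m) (hn : ν.IsDivisor n) :
    ν.IsDivisor (m.lcm n) := by
  refine ⟨Nat.lcm_ne_zero hm.1 hn.1, fun p => ?_⟩
  have := Fact.mk p.2
  have h : padicValNat p (m.lcm n) = max (padicValNat p m) (padicValNat p n) := by
    simp only [← Nat.factorization_def _ p.2, Nat.factorization_lcm hm.1 hn.1]
    rfl
  rw [h]
  rcases max_choice (padicValNat p m) (padicValNat p n) with h | h <;> rw [h]
  exacts [hm.2 p, hn.2 p]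

/-- If `m` exhausted every exponent of `ν`, their sum would be finite, so some prime has room left.
-/
lemma IsDivisor.exists_prime_mul {m : ℕ} (hm : ν.IsDivisor m) :
    ∃ p : Nat.Primes, ν.IsDivisor (m * p) := by
  obtain ⟨p, hp⟩ : ∃ p : Nat.Primes, (padicValNat p m : ℕ∞) < ν.exponent p := by
    by_contra! h
    -- Only primes dividing `m` contribute, and these are at most `m`; one finite sum bounds all
    -- partial sums.
    have hle : ⨆ s : Finset Nat.Primes, ∑ p ∈ s, ν.exponent p ≤
        ((∑ p ∈ Finset.range (m + 1), padicValNat p m : ℕ) : ℕ∞) := by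
      refine iSup_le fun s => ?_
      calc ∑ p ∈ s, ν.exponent p ≤ ∑ p ∈ s, (padicValNat p m : ℕ∞) :=
            Finset.sum_le_sum fun p _ => h p
        _ = ((∑ p ∈ s.map ⟨((↑) : Nat.Primes → ℕ), Subtype.val_injective⟩,
              padicValNat p m : ℕ) : ℕ∞) := by
            rw [Nat.cast_sum]
            exact (Finset.sum_map s ⟨((↑) : Nat.Primes → ℕ), Subtype.val_injective⟩
              fun p : ℕ => (padicValNat p m : ℕ∞)).symm
        _ ≤ _ := by
            refine Nat.cast_le.2 (Finset.sum_le_sum_of_ne_zero fun p _ hp => ?_)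
            rw [Finset.mem_range, Nat.lt_succ_iff]
            exact Nat.le_of_dvd (Nat.pos_of_ne_zero hm.1) (dvd_of_one_le_padicValNat
              (Nat.one_le_iff_ne_zero.2 hp))
    rw [ν.sum_eq_top] at hle
    exact absurd (top_le_iff.1 hle) (ENat.natCast_ne_top _)
  refine ⟨p, mul_ne_zero hm.1 p.2.ne_zero, fun q => ?_⟩
  have := Fact.mk p.2
  have := Fact.mk q.2
  rw [padicValNat.mul hm.1 p.2.ne_zero]
  by_cases hqp : q = p
  · subst hqp
    rw [padicValNat_self]
    push_cast
    exact Order.add_one_le_of_lt hp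
  · rw [padicValNat_primes fun h => hqp (Subtype.ext h)]
    exact hm.2 q

/-- Supplies arbitrarily fine subdivisions without leaving the class. -/
lemma IsDivisor.exists_le_mul {m : ℕ} (hm : ν.IsDivisor m) (K : ℕ) :
    ∃ N, K ≤ N ∧ ν.IsDivisor (m * N) := by
  induction K with
  | zero => exact ⟨1, zero_le_one, by simpa using hm⟩
  | succ K ih =>
    obtain ⟨N, hN, h⟩ := ih
    obtain ⟨p, hp⟩ := h.exists_prime_mul
    refine ⟨N * p, ?_, by rwa [← mul_assoc]⟩
    have h0 : N ≠ 0 := fun h0 => h.1 (by simp [h0])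
    have := p.2.two_le
    nlinarith [Nat.pos_of_ne_zero h0]

end SupernaturalNumber

end
noncomputable section

open MeasureTheory

/-! ### Quantile functions -/

lemma measure_Iic_lt_measure_Iic (μ : Measure unitInterval) [IsProbabilityMeasure μ]
    [μ.IsOpenPosMeasure] {x y : unitInterval} (h : x < y) :
    μ (Set.Iic x) < μ (Set.Iic y) := by
  have hd : Disjoint (Set.Iic x) (Set.Ioc x y) :=
    Set.disjoint_left.2 fun z hz hz' => not_lt.2 hz hz'.1
  rw [← Set.Iic_union_Ioc_eq_Iic h.le, measure_union hd measurableSet_Ioc]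
  refine ENNReal.lt_add_right (measure_ne_top _ _) (ne_of_gt ?_)
  exact (Measure.measure_Ioo_pos μ |>.2 h).trans_le (measure_mono Set.Ioo_subset_Ioc_self)

/-- Right continuity of the distribution function: the infimum defining the quantile is attained.
The point `1` is treated apart because it cannot be approached from above. -/
lemma le_measure_Iic_sInf (μ : Measure unitInterval) [IsProbabilityMeasure μ] {s : ENNReal}
    (hs : s ≤ 1) : s ≤ μ (Set.Iic (sInf {x : unitInterval | s ≤ μ (Set.Iic x)})) := by
  set x₀ := sInf {x : unitInterval | s ≤ μ (Set.Iic x)} with hx₀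
  rcases (unitInterval.le_one' : x₀ ≤ 1).eq_or_lt with h | h
  · rw [h]
    convert hs
    rw [← measure_univ (μ := μ)]
    congr 1
    exact Set.eq_univ_of_forall fun t => unitInterval.le_one'
  obtain ⟨u, hu, hmem, hlim⟩ := exists_seq_strictAnti_tendsto' h
  have hI : Set.Iic x₀ = ⋂ k, Set.Iic (u k) := by
    ext t
    simp only [Set.mem_Iic, Set.mem_iInter]
    exact ⟨fun ht k => ht.trans (hmem k).1.le, fun ht => ge_of_tendsto' hlim ht⟩
  have ht := tendsto_measure_iInter_atTop (μ := μ) (s := fun k => Set.Iic (u k))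
    (fun k => measurableSet_Iic.nullMeasurableSet)
    (fun i j hij => Set.Iic_subset_Iic.2 (hu.antitone hij)) ⟨0, measure_ne_top _ _⟩
  rw [hI]
  refine ge_of_tendsto' ht fun k => ?_
  obtain ⟨x, hx, hxu⟩ := sInf_lt_iff.1 (hx₀ ▸ (hmem k).1)
  exact le_trans hx (measure_mono (Set.Iic_subset_Iic.2 hxu.le))

/-- A probability measure of full support on `[0,1]` is the image of the Lebesgue measure under a
continuous map. -/
lemma exists_continuousMap_map_volume_eq (μ : Measure unitInterval) [IsProbabilityMeasure μ]
    [μ.IsOpenPosMeasure] :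
    ∃ φ : C(unitInterval, unitInterval), (volume : Measure unitInterval).map φ = μ := by
  let q : unitInterval → unitInterval := fun s =>
    sInf {x : unitInterval | ENNReal.ofReal s ≤ μ (Set.Iic x)}
  have gc : ∀ s x, q s ≤ x ↔ ENNReal.ofReal s ≤ μ (Set.Iic x) := fun s x =>
    ⟨fun h => (le_measure_Iic_sInf μ (ENNReal.ofReal_le_one.2 s.2.2)).trans
      (measure_mono (Set.Iic_subset_Iic.2 h)), fun h => sInf_le h⟩
  have hF : ∀ x, ∃ s : unitInterval, ENNReal.ofReal s = μ (Set.Iic x) := fun x =>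
    ⟨⟨μ.real (Set.Iic x), measureReal_nonneg, measureReal_le_one⟩, by simp⟩
  have hmono : Monotone q := fun s t hst => (gc _ _).2
    ((ENNReal.ofReal_le_ofReal hst).trans ((gc t _).1 le_rfl))
  -- Full support enters here: a strictly increasing distribution function `F` gives `q (F x) = x`.
  -- A monotone surjection is continuous, even when the measure has atoms.
  have hsurj : Function.Surjective q := fun x => by
    obtain ⟨s, hs⟩ := hF x
    refine ⟨s, le_antisymm ((gc _ _).2 hs.le) (le_of_not_gt fun h => ?_)⟩
    exact absurd ((gc s _).1 le_rfl) (not_le.2 (hs ▸ measure_Iic_lt_measure_Iic μ h))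
  have hc : Continuous q := hmono.continuous_of_surjective hsurj
  refine ⟨⟨q, hc⟩, Eq.symm (Measure.ext_of_Iic _ _ fun x => ?_)⟩
  obtain ⟨s, hs⟩ := hF x
  rw [ContinuousMap.coe_mk, Measure.map_apply hc.measurable measurableSet_Iic, ← hs, ← unitInterval.volume_Iic]
  congr 1
  ext t
  simp only [Set.mem_Iic, Set.mem_preimage]
  rw [gc, ← hs, ENNReal.ofReal_le_ofReal_iff s.2.1, Subtype.coe_le_coe]

/-! ### Traces on `C([0,1], Mₙ)` -/

namespace TracialState

variable {n : ℕ} (τ : TracialState (MatrixPath n))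

/-- Write `eᵢⱼ = eᵢₖ eₖⱼ` and swap the factors under the trace: `eₖⱼ eᵢₖ` is `eₖₖ` or `0`. -/
lemma apply_scalarPath_mul_single (g : C(unitInterval, ℂ)) (i j k : Fin n) :
    τ.toCLM (scalarPath n g * constPath (Matrix.single i j 1)) =
      if i = j then τ.toCLM (scalarPath n g * constPath (Matrix.single k k 1)) else 0 := by
  have h1 : scalarPath n g * constPath (Matrix.single i j 1) =
      scalarPath n g * constPath (Matrix.single i k 1) * constPath (Matrix.single k j 1) := by
    ext1 t; simp
  have h2 : constPath (Matrix.single k j 1) * (scalarPath n g * constPath (Matrix.single i k 1)) =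
      if i = j then scalarPath n g * constPath (Matrix.single k k 1) else 0 := by
    split_ifs with h
    · subst h
      ext1 t; simp
    · ext1 t
      simp [Matrix.single_mul_single_of_ne _ _ _ _ (Ne.symm h)]
  rw [h1, τ.tracial, h2]
  split_ifs <;> simp

lemma apply_eq_apply_trace (k : Fin n) (a : MatrixPath n) :
    τ.toCLM a = τ.toCLM (scalarPath n ⟨fun t => (a t).trace, by fun_prop⟩ *
      constPath (Matrix.single k k 1)) := by
  have h : scalarPath n ⟨fun t => (a t).trace, by fun_prop⟩ =
      ∑ i, scalarPath n ⟨fun t => a t i i, by fun_prop⟩ := by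
    rw [← map_sum]
    congr 1
    ext1 t
    simp [Matrix.trace]
  conv_lhs => rw [matrixPath_eq_sum a]
  rw [h, Finset.sum_mul, map_sum, map_sum]
  refine Finset.sum_congr rfl fun i _ => ?_
  rw [map_sum, Finset.sum_congr rfl fun j _ => τ.apply_scalarPath_mul_single _ i j k,
    Finset.sum_ite_eq, if_pos (Finset.mem_univ i)]

/-- A trace is determined by its values on the center. -/
lemma apply_eq_apply_scalarPath_ntr [NeZero n] (a : MatrixPath n) :
    τ.toCLM a = τ.toCLM (scalarPath n ⟨fun t => ntr n (a t),
      (continuous_ntr n).comp a.continuous⟩) := by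
  -- Both arguments have the same pointwise matrix trace, which is all that `τ` sees.
  rw [τ.apply_eq_apply_trace 0 a, τ.apply_eq_apply_trace 0 (scalarPath n _)]
  congr 3
  ext1 t
  have : (n : ℂ) ≠ 0 := by exact_mod_cast NeZero.ne n
  change (a t).trace = (ntr n (a t) • (1 : Matrix (Fin n) (Fin n) ℂ)).trace
  rw [Matrix.trace_smul, Matrix.trace_one, ntr_apply, Fintype.card_fin, smul_eq_mul]
  field_simp

/-- The real part of the center of `C([0,1], Mₙ)`. -/
def realPath (n : ℕ) : C(unitInterval, ℝ) →ₗ[ℝ] MatrixPath n where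
  toFun g := scalarPath n ⟨fun t => (g t : ℂ), by fun_prop⟩
  map_add' g h := by ext1 t; simp [add_smul]
  map_smul' c g := by ext1 t; simp [mul_smul]

@[simp] lemma realPath_apply (g : C(unitInterval, ℝ)) (t : unitInterval) :
    realPath n g t = (g t : ℂ) • 1 := rfl

lemma star_realPath_mul_self (g : C(unitInterval, ℝ)) :
    star (realPath n g) * realPath n g = realPath n (g * g) := by
  ext1 t
  simp only [ContinuousMap.mul_apply, ContinuousMap.star_apply, realPath_apply, star_smul, star_one,
    RCLike.star_def, Complex.conj_ofReal, smul_mul_smul_comm, mul_one, Complex.ofReal_mul]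

/-- Positivity makes the trace real on squares, and `4g = (g+1)² - (g-1)²`. -/
lemma im_apply_realPath (g : C(unitInterval, ℝ)) : (τ.toCLM (realPath n g)).im = 0 := by
  have h : ∀ f : C(unitInterval, ℝ), (τ.toCLM (realPath n (f * f))).im = 0 := fun f => by
    rw [← star_realPath_mul_self]
    exact (Complex.le_def.1 (τ.nonneg _)).2.symm
  have hg : (4 : ℝ) • g = (g + 1) * (g + 1) - (g - 1) * (g - 1) := by
    ext1 t
    simp
    ring
  have h4 : ((4 : ℝ) • τ.toCLM (realPath n g)).im = 0 := by
    have : (4 : ℝ) • τ.toCLM (realPath n g) = τ.toCLM (realPath n ((4 : ℝ) • g)) := by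
      rw [map_smul, ContinuousLinearMap.map_smul_of_tower]
    rw [this, hg, map_sub, map_sub, Complex.sub_im, h, h, sub_zero]
  simpa using h4

/-- The restriction of a trace to the real part of the center, as a positive functional. -/
def centerFunctional : CompactlySupportedContinuousMap unitInterval ℝ →ₚ[ℝ] ℝ :=
  PositiveLinearMap.mk₀
    { toFun := fun g => (τ.toCLM (realPath n g.toContinuousMap)).re
      map_add' := fun f g => by
        rw [show (f + g).toContinuousMap = f.toContinuousMap + g.toContinuousMap from rfl]
        simp
      map_smul' := fun c g => by
        rw [show (c • g).toContinuousMap = c • g.toContinuousMap from rfl, map_smul,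
          ContinuousLinearMap.map_smul_of_tower]
        simp } fun g hg => by
      -- A nonnegative function is the square of its root, so positivity of `τ` applies.
      have h : g.toContinuousMap = ⟨fun t => √(g t), by fun_prop⟩ * ⟨fun t => √(g t), by fun_prop⟩ := by
        ext1 t
        exact (Real.mul_self_sqrt (hg t)).symm
      change 0 ≤ (τ.toCLM (realPath n g.toContinuousMap)).re
      rw [h, ← star_realPath_mul_self]
      exact (Complex.le_def.1 (τ.nonneg _)).1

/-- The measure on `[0,1]` representing a trace. -/
def measure : Measure unitInterval := RealRMK.rieszMeasure τ.centerFunctional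

lemma apply_realPath (g : C(unitInterval, ℝ)) :
    τ.toCLM (realPath n g) = ((∫ t, g t ∂τ.measure : ℝ) : ℂ) := by
  have h := RealRMK.integral_rieszMeasure τ.centerFunctional
    (CompactlySupportedContinuousMap.continuousMapEquiv g)
  refine Complex.ext ?_ (τ.im_apply_realPath g)
  rw [Complex.ofReal_re]
  exact h.symm

instance : IsFiniteMeasure τ.measure := by
  unfold measure
  infer_instance

instance : IsProbabilityMeasure τ.measure := by
  have h := τ.apply_realPath 1
  have h1 : realPath n 1 = 1 := by ext1 t; simp
  rw [h1, τ.map_one] at h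
  simp only [ContinuousMap.one_apply, integral_const, smul_eq_mul, mul_one] at h
  constructor
  have h2 : τ.measure.real Set.univ = 1 := by exact_mod_cast h.symm
  rw [Measure.real, ENNReal.toReal_eq_one_iff] at h2
  exact h2

variable {τ} in
-- On a null interval `(a, b)`, the tent function supported there would be a nonzero element with
-- `τ(g* g) = 0`.
lemma IsFaithful.isOpenPosMeasure [NeZero n] (hτ : τ.IsFaithful) : τ.measure.IsOpenPosMeasure where
  open_pos U hU hne := by
    obtain ⟨x, hx⟩ := hne
    obtain ⟨a, b, hab, h⟩ := hU.exists_Ioo_subset ⟨x, hx⟩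
    refine fun h0 => ?_
    have h1 : τ.measure (Set.Ioo a b) = 0 := measure_mono_null h h0
    let g : C(unitInterval, ℝ) := ⟨fun t => max 0 (min (t - a) (b - t)), by fun_prop⟩
    have hint : ∫ t, (g * g) t ∂τ.measure = 0 := by
      refine integral_eq_zero_of_ae ?_
      filter_upwards [measure_eq_zero_iff_ae_notMem.1 h1] with t ht
      have : g t = 0 := by
        refine max_eq_left ?_
        by_contra! hc
        obtain ⟨h2, h3⟩ := lt_min_iff.1 hc
        exact ht ⟨Subtype.coe_lt_coe.1 (sub_pos.1 h2), Subtype.coe_lt_coe.1 (sub_pos.1 h3)⟩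
      simp [this]
    have hz : realPath n g = 0 := by
      refine hτ _ ?_
      rw [star_realPath_mul_self, τ.apply_realPath, hint, Complex.ofReal_zero]
    obtain ⟨c, hac, hcb⟩ := exists_between hab
    have hc : realPath n g c = 0 := by rw [hz]; rfl
    have hgc : g c = 0 := by
      have h2 := congrFun (congrFun hc 0) 0
      simpa using h2
    have : 0 < g c := lt_max_of_lt_right (lt_min (sub_pos.2 hac) (sub_pos.2 hcb))
    exact this.ne' hgc

lemma apply_scalarPath (g : C(unitInterval, ℂ)) :
    τ.toCLM (scalarPath n g) = ∫ t, g t ∂τ.measure := by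
  have hint : Integrable g τ.measure :=
    g.continuous.integrable_of_hasCompactSupport (HasCompactSupport.of_compactSpace g)
  have h : scalarPath n g = realPath n ⟨fun t => (g t).re, by fun_prop⟩ +
      Complex.I • realPath n ⟨fun t => (g t).im, by fun_prop⟩ := by
    ext1 t
    simp only [ContinuousMap.add_apply, ContinuousMap.smul_apply, realPath_apply,
      scalarPath_apply, ContinuousMap.coe_mk, smul_smul, ← add_smul]
    rw [mul_comm, Complex.re_add_im]
  rw [h, map_add, map_smul, apply_realPath, apply_realPath, smul_eq_mul, mul_comm]
  exact integral_re_add_im hint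

/-- A faithful trace on `C([0,1], Mₙ)` is the pullback of the Lebesgue trace under composition with
a continuous map. -/
lemma IsFaithful.exists_apply_eq_integral [NeZero n] {τ : TracialState (MatrixPath n)}
    (hτ : τ.IsFaithful) : ∃ φ : C(unitInterval, unitInterval), ∀ a : MatrixPath n,
      τ.toCLM a = ∫ t, ntr n (a (φ t)) := by
  have := hτ.isOpenPosMeasure
  obtain ⟨φ, hφ⟩ := exists_continuousMap_map_volume_eq τ.measure
  refine ⟨φ, fun a => ?_⟩
  rw [apply_eq_apply_scalarPath_ntr, apply_scalarPath, ← hφ]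
  have hc : Continuous fun t => ntr n (a t) := (continuous_ntr n).comp a.continuous
  exact integral_map φ.continuous.aemeasurable hc.aestronglyMeasurable

end TracialState

end
noncomputable section

open MeasureTheory

/-! ### Finite-dimensional representations of `C([0,1], Mₙ)` -/

lemma scalarPath_mul_comm {n : ℕ} (g : C(unitInterval, ℂ)) (a : MatrixPath n) :
    scalarPath n g * a = a * scalarPath n g := by
  ext1 t; simp

lemma constPath_single_mul_single {n : ℕ} (i j k l : Fin n) :
    constPath (Matrix.single i j 1) * constPath (Matrix.single k l 1) =
      if j = k then constPath (Matrix.single i l (1 : ℂ)) else 0 := by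
  split_ifs with h
  · subst h
    ext1 t; simp
  · ext1 t
    simp [Matrix.single_mul_single_of_ne _ _ _ _ h]

lemma star_constPath_single {n : ℕ} (i j : Fin n) :
    star (constPath (Matrix.single i j (1 : ℂ))) = constPath (Matrix.single j i 1) := by
  ext1 t
  change (Matrix.single i j (1 : ℂ)).conjTranspose = _
  simp

lemma sum_constPath_single {n : ℕ} :
    ∑ i, constPath (Matrix.single i i (1 : ℂ)) = (1 : MatrixPath n) := by
  ext1 t
  simp only [ContinuousMap.coe_sum, Finset.sum_apply, ContinuousMap.const_apply,
    ContinuousMap.one_apply]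
  ext i j
  simp [Matrix.sum_apply, Matrix.single_apply, Matrix.one_apply, ite_and]

section Representation

variable {n : ℕ} {E : Type*} [NormedAddCommGroup E] [InnerProductSpace ℂ E]
  [FiniteDimensional ℂ E]

lemma inner_starAlgHom_left {A : Type*} [CStarAlgebra A] (π : A →⋆ₐ[ℂ] (E →L[ℂ] E)) (a : A)
    (x y : E) : inner ℂ (π a x) y = inner ℂ x (π (star a) y) := by
  rw [map_star, ContinuousLinearMap.star_eq_adjoint, ContinuousLinearMap.adjoint_inner_right]

/-- Both `t` and `1 - t` are squares of real functions on `[0,1]`, so their images are positive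
operators. -/
lemma eigenvalue_mem_unitInterval (π : MatrixPath n →⋆ₐ[ℂ] (E →L[ℂ] E)) {v : E} (hv : ‖v‖ = 1)
    {r : ℝ} (h : π (scalarPath n coordinate) v = (r : ℂ) • v) : r ∈ Set.Icc (0 : ℝ) 1 := by
  have key : ∀ g : C(unitInterval, ℝ), ∀ s : ℝ,
      π (TracialState.realPath n (g * g)) v = (s : ℂ) • v → 0 ≤ s := by
    intro g s hs
    have h1 : inner ℂ (π (TracialState.realPath n g) v) (π (TracialState.realPath n g) v) =
        (s : ℂ) := by
      rw [inner_starAlgHom_left, ← mul_apply_eq_comp, ← map_mul,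
        TracialState.star_realPath_mul_self, hs, inner_smul_right, inner_self_eq_norm_sq_to_K, hv]
      simp
    rw [inner_self_eq_norm_sq_to_K] at h1
    have h2 : ‖π (TracialState.realPath n g) v‖ ^ 2 = s := by
      rw [← Complex.ofReal_inj, ← h1]
      push_cast
      rfl
    rw [← h2]
    positivity
  let g₀ : C(unitInterval, ℝ) := ⟨fun t => √(t : ℝ), by fun_prop⟩
  let g₁ : C(unitInterval, ℝ) := ⟨fun t => √(1 - t : ℝ), by fun_prop⟩
  have e0 : TracialState.realPath n (g₀ * g₀) = scalarPath n coordinate := by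
    ext1 t
    simp only [TracialState.realPath_apply, ContinuousMap.mul_apply, ContinuousMap.coe_mk, g₀,
      Real.mul_self_sqrt t.2.1, scalarPath_apply, coordinate_apply]
  have e1 : TracialState.realPath n (g₁ * g₁) = 1 - scalarPath n coordinate := by
    ext1 t
    simp only [TracialState.realPath_apply, ContinuousMap.mul_apply, ContinuousMap.coe_mk, g₁,
      Real.mul_self_sqrt (sub_nonneg.2 t.2.2), scalarPath_apply, coordinate_apply,
      ContinuousMap.sub_apply, ContinuousMap.one_apply, Complex.ofReal_sub, Complex.ofReal_one,
      sub_smul, one_smul]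
  refine ⟨key g₀ r (by rw [e0, h]), sub_nonneg.1 (key g₁ (1 - r) ?_)⟩
  rw [e1, map_sub, map_one, sub_apply, h, one_apply_eq_self,
    Complex.ofReal_sub, Complex.ofReal_one, sub_smul, one_smul]

/-- A representation of `C([0,1], Mₙ)` on a finite-dimensional Hilbert space has an orthonormal
basis permuted by the matrix units and diagonalizing the coordinate function. -/
lemma exists_orthonormalBasis_matrixPath [NeZero n] (π : MatrixPath n →⋆ₐ[ℂ] (E →L[ℂ] E)) :
    ∃ (k : ℕ) (w : OrthonormalBasis (Fin n × Fin k) ℂ E) (y : Fin k → unitInterval), Antitone y ∧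
      (∀ i l, π (scalarPath n coordinate) (w (i, l)) = ((y l : ℝ) : ℂ) • w (i, l)) ∧
      ∀ a b i l, π (constPath (Matrix.single a b 1)) (w (i, l)) =
        if b = i then w (a, l) else 0 := by
  set e : Fin n → Fin n → E →L[ℂ] E := fun i j => π (constPath (Matrix.single i j 1)) with he
  have hmul : ∀ i j k l x, e i j (e k l x) = if j = k then e i l x else 0 := by
    intro i j k l x
    rw [← mul_apply_eq_comp, he, ← map_mul, constPath_single_mul_single]
    split_ifs <;> simp
  have hadj : ∀ i j x y, inner ℂ (e i j x) y = inner ℂ x (e j i y) := by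
    intro i j x y
    rw [he, inner_starAlgHom_left, star_constPath_single]
  have hsum : ∀ x, ∑ i, e i i x = x := by
    intro x
    rw [← sum_apply, he, ← map_sum, sum_constPath_single, map_one,
      one_apply_eq_self]
  set T : E →L[ℂ] E := π (scalarPath n coordinate) with hT
  have hTe : ∀ i j x, T (e i j x) = e i j (T x) := by
    intro i j x
    rw [← mul_apply_eq_comp, ← mul_apply_eq_comp, he, hT, ← map_mul,
      scalarPath_mul_comm, map_mul]
  have hTsymm : (T : E →ₗ[ℂ] E).IsSymmetric := by
    intro x y
    have : star (scalarPath n coordinate) = scalarPath n coordinate := by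
      rw [← map_star]; congr 1; ext1 t; simp
    change inner ℂ (T x) y = inner ℂ x (T y)
    rw [hT, inner_starAlgHom_left, this]
  -- The range of `e₀₀` is the multiplicity space. It is invariant under `T`, which commutes with
  -- the matrix units; an eigenbasis of `T` on it is transported to the other blocks by `eᵢ₀`.
  let V : Submodule ℂ E := LinearMap.range (e 0 0 : E →ₗ[ℂ] E)
  have hV : ∀ v, v ∈ V ↔ e 0 0 v = v := by
    intro v
    refine ⟨?_, fun h => ⟨v, h⟩⟩
    rintro ⟨x, rfl⟩
    exact (hmul 0 0 0 0 x).trans (if_pos rfl)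
  have hTV : ∀ v ∈ V, (T : E →ₗ[ℂ] E) v ∈ V := by
    intro v hv
    rw [hV] at hv ⊢
    change e 0 0 (T v) = T v
    rw [← hTe, hv]
  have hTV' := hTsymm.restrict_invariant hTV
  let b := hTV'.eigenvectorBasis rfl
  have hb : ∀ l, e 0 0 (b l : E) = b l := fun l => (hV _).1 (b l).2
  have hTb : ∀ l, T (b l : E) = ((hTV'.eigenvalues rfl l : ℝ) : ℂ) • (b l : E) := fun l =>
    congrArg (Subtype.val) (hTV'.apply_eigenvectorBasis rfl l)
  have horth : Orthonormal ℂ fun p : Fin n × Fin (Module.finrank ℂ V) => e p.1 0 (b p.2 : E) := by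
    rw [orthonormal_iff_ite]
    rintro ⟨i, l⟩ ⟨j, m⟩
    rw [hadj, hmul]
    by_cases hij : i = j
    · rw [if_pos hij, hb]
      have h1 := orthonormal_iff_ite.1 b.orthonormal l m
      rw [Submodule.coe_inner] at h1
      rw [h1]
      simp [hij]
    · simp [hij]
  have hspan : ⊤ ≤ Submodule.span ℂ (Set.range fun p : Fin n × Fin (Module.finrank ℂ V) =>
      e p.1 0 (b p.2 : E)) := by
    intro x _
    rw [← hsum x]
    refine sum_mem fun i _ => ?_
    have h1 : e i i x = e i 0 (e 0 i x) := by rw [hmul, if_pos rfl]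
    have h2 : e 0 i x ∈ V := by rw [hV, hmul, if_pos rfl]
    have h3 := b.sum_repr ⟨_, h2⟩
    have h4 : e 0 i x = ∑ l, b.repr ⟨_, h2⟩ l • (b l : E) := by
      conv_lhs => rw [show e 0 i x = ((⟨_, h2⟩ : V) : E) from rfl, ← h3]
      simp
    rw [h1, h4, map_sum]
    refine sum_mem fun l _ => ?_
    rw [map_smul]
    exact Submodule.smul_mem _ _ (Submodule.subset_span ⟨(i, l), rfl⟩)
  have hy : ∀ l, hTV'.eigenvalues rfl l ∈ Set.Icc (0 : ℝ) 1 := fun l =>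
    eigenvalue_mem_unitInterval π (b.orthonormal.1 l) (hTb l)
  refine ⟨_, OrthonormalBasis.mk horth hspan, fun l => ⟨_, hy l⟩,
    fun l m hlm => hTV'.eigenvalues_antitone rfl hlm, fun i l => ?_, fun a c i l => ?_⟩
  · rw [OrthonormalBasis.coe_mk]
    change T (e i 0 (b l : E)) = _ • e i 0 (b l : E)
    rw [hTe, hTb, map_smul]
  · rw [OrthonormalBasis.coe_mk]
    exact hmul a c i 0 _

end Representation

/-- Evaluation at finitely many points. -/
def evalPoints (n : ℕ) {k : ℕ} (y : Fin k → unitInterval) :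
    MatrixPath n →⋆ₐ[ℂ] (Fin k → Matrix (Fin n) (Fin n) ℂ) where
  toFun a l := a (y l)
  map_one' := rfl
  map_mul' _ _ := rfl
  map_zero' := rfl
  map_add' _ _ := rfl
  commutes' _ := rfl
  map_star' _ := rfl

/-- A matrix representation of `C([0,1], Mₙ)` is unitarily equivalent to a direct sum of point
evaluations. -/
lemma exists_unitary_conj_eq {n k M : ℕ} [NeZero n] (e : Fin n × Fin k ≃ Fin M)
    (ρ : MatrixPath n →⋆ₐ[ℂ] Matrix (Fin M) (Fin M) ℂ) :
    ∃ u ∈ unitary (Matrix (Fin M) (Fin M) ℂ), ∃ y : Fin k → unitInterval, Antitone y ∧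
      ∀ a, ρ a = u * blockHom e (fun l => a (y l)) * star u := by
  let π : MatrixPath n →⋆ₐ[ℂ] (EuclideanSpace ℂ (Fin M) →L[ℂ] EuclideanSpace ℂ (Fin M)) :=
    (Matrix.toEuclideanCLM (n := Fin M) (𝕜 := ℂ) : _ →⋆ₐ[ℂ] _).comp ρ
  obtain ⟨k', w, y, hy, h1, h2⟩ := exists_orthonormalBasis_matrixPath π
  obtain rfl : k' = k := by
    have e1 := Module.finrank_eq_card_basis w.toBasis
    have e2 := Fintype.card_congr e
    simp at e1 e2
    rw [e1] at e2
    exact (Nat.eq_of_mul_eq_mul_left (Nat.pos_of_ne_zero (NeZero.ne n)) e2).symm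
  -- The columns of `u` are the adapted orthonormal basis.
  let u : Matrix (Fin M) (Fin M) ℂ := Matrix.of fun p q => w (e.symm q) p
  have hu1 : star u * u = 1 := by
    ext p q
    have h := orthonormal_iff_ite.1 w.orthonormal (e.symm p) (e.symm q)
    rw [PiLp.inner_apply] at h
    simp only [RCLike.inner_apply, e.symm.injective.eq_iff] at h
    rw [Matrix.mul_apply, Matrix.one_apply, ← h]
    refine Finset.sum_congr rfl fun r _ => ?_
    simp [u, Matrix.star_apply, mul_comm]
  have hu : u ∈ unitary (Matrix (Fin M) (Fin M) ℂ) :=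
    Unitary.mem_iff.2 ⟨hu1, mul_eq_one_comm.1 hu1⟩
  have hcol : ∀ a, (∀ j l, π a (w (j, l)) = ∑ i, a (y l) i j • w (i, l)) →
      ρ a = u * blockHom e (fun l => a (y l)) * star u := by
    intro a ha
    have h3 : ρ a * u = u * blockHom e (fun l => a (y l)) := by
      ext p q
      obtain ⟨⟨j, l⟩, rfl⟩ := e.surjective q
      have h4 : (ρ a * u) p (e (j, l)) = (π a (w (j, l))) p := by
        change _ = ((Matrix.toEuclideanCLM (n := Fin M) (𝕜 := ℂ) (ρ a)) (w (j, l))) p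
        rw [Matrix.ofLp_toEuclideanCLM]
        simp [Matrix.mul_apply, Matrix.mulVec, dotProduct, u]
      rw [h4, ha, Matrix.mul_apply, ← e.sum_comp, Fintype.sum_prod_type]
      simp [blockHom_apply, Matrix.blockDiagonal_apply, u, mul_comm]
    rw [← h3, mul_assoc, Unitary.mul_star_self_of_mem hu, mul_one]
  refine ⟨u, hu, y, hy, fun a => ?_⟩
  have hext : ρ = ((Unitary.conjStarAlgAut ℂ (Matrix (Fin M) (Fin M) ℂ) ⟨u, hu⟩ : _ →⋆ₐ[ℂ] _).comp
      ((blockHom e).comp (evalPoints n y))) := by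
    refine matrixPath_starAlgHom_ext (hcol _ fun j l => ?_) fun a b => hcol _ fun j l => ?_
    · rw [h1]
      simp [Matrix.one_apply]
    · rw [h2]
      simp [Matrix.single_apply, ite_and]
  exact congrArg (fun φ : MatrixPath n →⋆ₐ[ℂ] Matrix (Fin M) (Fin M) ℂ => φ a) hext

end
noncomputable section

open MeasureTheory

/-! ### Embeddings into the Lebesgue trace, and the joint embedding property -/

/-- Compose with the quantile function and repeat the result `m / n` times down the diagonal. -/
lemma TracialState.IsFaithful.nonempty_embedding_lebesgueTrace {n m : ℕ} [NeZero m] (h : n ∣ m)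
    {τ : TracialState (MatrixPath n)} (hτ : τ.IsFaithful) :
    Nonempty (MetricStructure.Embedding τ.toMetricStructure
      (lebesgueTrace m).toMetricStructure) := by
  obtain ⟨N, rfl⟩ := h
  have : NeZero n := ⟨fun h => NeZero.ne (n * N) (by simp [h])⟩
  have hN : (N : ℂ) ≠ 0 := fun h => NeZero.ne (n * N) (by simp [Nat.cast_eq_zero.1 h])
  obtain ⟨φ, hφ⟩ := hτ.exists_apply_eq_integral
  refine ⟨(pathHom finProdFinEquiv fun _ => φ).toTracialEmbedding hτ fun a => ?_⟩
  rw [lebesgueTrace_pathHom, hφ]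
  simp [hN]

lemma TracialState.IsFaithful.norm_apply_le {n : ℕ} [NeZero n] {τ : TracialState (MatrixPath n)}
    (hτ : τ.IsFaithful) (a : MatrixPath n) : ‖τ.toCLM a‖ ≤ ‖a‖ := by
  obtain ⟨φ, hφ⟩ := hτ.exists_apply_eq_integral
  rw [hφ]
  refine (norm_integral_le_of_norm_le_const (C := ‖a‖) (.of_forall fun t => ?_)).trans ?_
  · exact (norm_ntr_le _).trans (a.norm_coe_le_norm _)
  · simp

namespace SupernaturalNumber

variable {ν : SupernaturalNumber}

lemma IsDivisor.lebesgueTrace_mem {n : ℕ} [NeZero n] (hn : ν.IsDivisor n) :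
    (lebesgueTrace n).toMetricStructure ∈ ν.matrixPathClass :=
  ⟨n, hn, _, lebesgueTrace_isFaithful n, rfl⟩

lemma jep_matrixPathClass : MetricStructure.JEP ν.matrixPathClass := by
  rintro _ ⟨n, hn, τ, hτ, rfl⟩ _ ⟨m, hm, σ, hσ, rfl⟩
  have hd := hn.lcm hm
  have : NeZero (n.lcm m) := ⟨hd.1⟩
  exact ⟨_, hd.lebesgueTrace_mem,
    hτ.nonempty_embedding_lebesgueTrace (Nat.dvd_lcm_left n m),
    hσ.nonempty_embedding_lebesgueTrace (Nat.dvd_lcm_right n m)⟩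

end SupernaturalNumber

/-! ### The pseudometric -/

namespace MetricStructure

variable {L : MetricLanguage} {K : Set (MetricStructure L)} {n : ℕ}

lemma Pointed.dist_le (x y : Pointed K n) {C : MetricStructure L} (hC : C ∈ K)
    (f : Embedding x.str C) (g : Embedding y.str C) :
    x.dist y ≤ Dist.dist (fun i => f (x.tup i)) (fun i => g (y.tup i)) :=
  csInf_le ⟨0, by rintro _ ⟨C, _, f, g, rfl⟩; exact dist_nonneg⟩ ⟨C, hC, f, g, rfl⟩

lemma Pointed.exists_dist_lt (hK : JEP K) {x y : Pointed K n} {r : ℝ} (h : x.dist y < r) :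
    ∃ C ∈ K, ∃ (f : Embedding x.str C) (g : Embedding y.str C),
      Dist.dist (fun i => f (x.tup i)) (fun i => g (y.tup i)) < r := by
  have hne : {r : ℝ | ∃ C ∈ K, ∃ (f : Embedding x.str C) (g : Embedding y.str C),
      r = Dist.dist (fun i => f (x.tup i)) (fun i => g (y.tup i))}.Nonempty := by
    obtain ⟨C, hC, ⟨f⟩, ⟨g⟩⟩ := hK _ x.mem _ y.mem
    exact ⟨_, C, hC, f, g, rfl⟩
  obtain ⟨_, ⟨C, hC, f, g, rfl⟩, hr⟩ := exists_lt_of_csInf_lt hne h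
  exact ⟨C, hC, f, g, hr⟩

/-- A class whose members embed into countably many separable members has the weak Polish
property. -/
lemma wpp_of_countable {ι : Type*} [Countable ι] (C : ι → MetricStructure L)
    (hC : ∀ i, C i ∈ K) (hsep : ∀ i, TopologicalSpace.SeparableSpace (C i))
    (hemb : ∀ A ∈ K, ∃ i, Nonempty (Embedding A (C i))) : WPP K := by
  intro n
  have key : ∀ i, ∃ D : Set (Pointed K n), D.Countable ∧ ∀ x : Pointed K n,
      Nonempty (Embedding x.str (C i)) → ∀ ε : ℝ, 0 < ε → ∃ y ∈ D, x.dist y < ε := by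
    intro i
    have := hsep i
    have : SecondCountableTopology (C i) := UniformSpace.secondCountable_of_separable _
    let P := {x : Pointed K n // Nonempty (Embedding x.str (C i))}
    -- Density is taken inside the range of `g`, so that every approximating tuple comes from an
    -- actual member of `𝒦ₙ`.
    let g : P → Fin n → C i := fun x j => x.2.some (x.1.tup j)
    obtain ⟨T, hT, hTd⟩ := TopologicalSpace.exists_countable_dense (Set.range g)
    have hcoe : ∀ t : Set.range g, ∃ x, g x = t := fun t => t.2
    choose s hs using hcoe
    refine ⟨(fun t => (s t).1) '' T, hT.image _, ?_⟩
    intro x hx ε hε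
    obtain ⟨t, ht, htT⟩ := hTd.exists_dist_lt ⟨g ⟨x, hx⟩, Set.mem_range_self _⟩ hε
    refine ⟨_, ⟨t, ht, rfl⟩, lt_of_le_of_lt (x.dist_le _ (hC i) hx.some (s t).2.some) ?_⟩
    have h2 : Dist.dist (g ⟨x, hx⟩) (g (s t)) < ε := by
      rw [hs]; exact htT
    exact h2
  choose D hD hDd using key
  refine ⟨⋃ i, D i, Set.countable_iUnion hD, fun x ε hε => ?_⟩
  obtain ⟨i, hi⟩ := hemb _ x.mem
  obtain ⟨y, hy, h⟩ := hDd i x hi ε hε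
  exact ⟨y, Set.mem_iUnion.2 ⟨_, hy⟩, h⟩

end MetricStructure

/-! ### The weak Polish property for the class attached to `ν` -/

namespace SupernaturalNumber

open MetricStructure

variable {ν : SupernaturalNumber}

lemma wpp_matrixPathClass : WPP ν.matrixPathClass := by
  have hne : ∀ n : {n // ν.IsDivisor n}, NeZero n.1 := fun n => ⟨n.2.1⟩
  refine wpp_of_countable (fun n : {n // ν.IsDivisor n} =>
    (lebesgueTrace n.1).toMetricStructure) (fun n => n.2.lebesgueTrace_mem) (fun n => ?_) ?_
  · change TopologicalSpace.SeparableSpace (MatrixPath n.1)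
    infer_instance
  · rintro _ ⟨n, hn, τ, hτ, rfl⟩
    have : NeZero n := ⟨hn.1⟩
    exact ⟨⟨n, hn⟩, hτ.nonempty_embedding_lebesgueTrace dvd_rfl⟩

/-! ### The Cauchy continuity property -/

/-- The factor `2` is needed only for the distance, whose two arguments both move; the trace is a
contraction. -/
lemma dist_predMap_le {C : MetricStructure tracialLanguage} (hC : C ∈ ν.matrixPathClass) {n : ℕ}
    (P : tracialLanguage.Pred n) (u v : Fin n → C) :
    dist (C.predMap P u) (C.predMap P v) ≤ 2 * dist u v := by
  obtain ⟨m, hm, τ, hτ, rfl⟩ := hC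
  have : NeZero m := ⟨hm.1⟩
  have key : ∀ u v : Fin n → MatrixPath m,
      dist (tracialPredMap τ P u) (tracialPredMap τ P v) ≤ 2 * dist u v := by
    intro u v
    have h1 : ∀ i, dist (τ.toCLM (u i)) (τ.toCLM (v i)) ≤ 2 * dist u v := fun i => by
      rw [dist_eq_norm, ← map_sub]
      refine (hτ.norm_apply_le _).trans ?_
      rw [← dist_eq_norm]
      exact (dist_le_pi_dist u v i).trans (by linarith [dist_nonneg (x := u) (y := v)])
    cases P
    · simp only [tracialPredMap]
      refine (dist_dist_dist_le _ _ _ _).trans ?_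
      linarith [dist_le_pi_dist u v 0, dist_le_pi_dist u v 1]
    · simp only [tracialPredMap]
      refine le_trans ?_ (h1 0)
      rw [Real.dist_eq, ← Complex.sub_re, dist_eq_norm]
      exact Complex.abs_re_le_norm _
    · simp only [tracialPredMap]
      refine le_trans ?_ (h1 0)
      rw [Real.dist_eq, ← Complex.sub_im, dist_eq_norm]
      exact Complex.abs_im_le_norm _
  exact key u v

/-- The zero of a tracial structure. -/
def zeroOf (C : MetricStructure tracialLanguage) : C := C.funMap TracialFun.zero ![]

lemma map_zeroOf {C D : MetricStructure tracialLanguage} (f : Embedding C D) :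
    f (zeroOf C) = zeroOf D := by
  have h := f.map_fun (n := 0) TracialFun.zero ![]
  rw [Subsingleton.elim (fun i => f (![] i)) ![]] at h
  exact h.symm

/-- The function symbols are uniformly Lipschitz on bounded sets. -/
lemma exists_dist_funMap_le {n : ℕ} (F : tracialLanguage.Fun n) {R : ℝ} (hR : 0 ≤ R) :
    ∃ c : ℝ, 1 ≤ c ∧ ∀ C ∈ ν.matrixPathClass, ∀ u v : Fin n → C,
      (∀ i, dist (u i) (zeroOf C) ≤ R) → (∀ i, dist (v i) (zeroOf C) ≤ R) →
      dist (C.funMap F u) (C.funMap F v) ≤ c * dist u v := by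
  suffices h : ∃ c : ℝ, 0 ≤ c ∧ ∀ m : ℕ, ∀ u v : Fin n → MatrixPath m, (∀ i, ‖u i‖ ≤ R) →
      (∀ i, ‖v i‖ ≤ R) →
      dist (tracialFunMap (MatrixPath m) F u) (tracialFunMap (MatrixPath m) F v) ≤
        c * dist u v by
    obtain ⟨c, hc, h⟩ := h
    -- Enlarging the constant to at least `1` lets the same estimate cover the unchanged coordinates
    -- in CCP.
    refine ⟨c + 1, by linarith, ?_⟩
    rintro _ ⟨m, hm, τ, hτ, rfl⟩ u v hu hv
    refine (h m u v (fun i => ?_) fun i => ?_).trans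
      (mul_le_mul_of_nonneg_right (by linarith) dist_nonneg)
    · exact (dist_zero_right (E := MatrixPath m) (u i)).symm.trans_le (hu i)
    · exact (dist_zero_right (E := MatrixPath m) (v i)).symm.trans_le (hv i)
  have hd : ∀ (m : ℕ) (u v : Fin n → MatrixPath m) i, ‖u i - v i‖ ≤ dist u v := fun m u v i => by
    rw [← dist_eq_norm]; exact dist_le_pi_dist u v i
  cases F with
  | zero => exact ⟨0, le_rfl, fun m u v _ _ => by simp [tracialFunMap]⟩
  | one => exact ⟨0, le_rfl, fun m u v _ _ => by simp [tracialFunMap]⟩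
  | star =>
    refine ⟨1, zero_le_one, fun m u v _ _ => ?_⟩
    simp only [tracialFunMap]
    rw [dist_eq_norm, ← star_sub, norm_star, one_mul]
    exact hd m u v 0
  | smul c =>
    refine ⟨‖c‖, norm_nonneg _, fun m u v _ _ => ?_⟩
    simp only [tracialFunMap]
    rw [dist_eq_norm, show c • u 0 - c • v 0 = c • (u 0 - v 0) from (smul_sub c (u 0) (v 0)).symm,
      norm_smul]
    exact mul_le_mul_of_nonneg_left (hd m u v 0) (norm_nonneg _)
  | add =>
    refine ⟨2, zero_le_two, fun m u v _ _ => ?_⟩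
    simp only [tracialFunMap]
    refine (dist_add_add_le _ _ _ _).trans ?_
    linarith [dist_le_pi_dist u v 0, dist_le_pi_dist u v 1]
  | mul =>
    refine ⟨2 * R, by positivity, fun m u v hu hv => ?_⟩
    simp only [tracialFunMap]
    have h1 : u 0 * u 1 - v 0 * v 1 = u 0 * (u 1 - v 1) + (u 0 - v 0) * v 1 := by
      rw [mul_sub, sub_mul]; abel
    rw [dist_eq_norm, h1]
    calc ‖u 0 * (u 1 - v 1) + (u 0 - v 0) * v 1‖
        ≤ ‖u 0‖ * ‖u 1 - v 1‖ + ‖u 0 - v 0‖ * ‖v 1‖ :=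
          (norm_add_le _ _).trans (add_le_add (norm_mul_le _ _) (norm_mul_le _ _))
      _ ≤ R * dist u v + dist u v * R := by
          gcongr
          exacts [hu 0, hd m u v 1, hd m u v 0, hv 1]
      _ = 2 * R * dist u v := by ring

/-- Embeddings are isometric and preserve zero, so norms can be compared with those of one fixed
term inside a common extension. -/
lemma exists_dist_zeroOf_le {n : ℕ} {x : ℕ → Pointed ν.matrixPathClass n}
    (hx : Pointed.IsCauchy x) :
    ∃ (R : ℝ) (N : ℕ), 0 ≤ R ∧ ∀ k ≥ N, ∀ i, dist ((x k).tup i) (zeroOf (x k).str) ≤ R := by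
  obtain ⟨N, hN⟩ := hx 1 one_pos
  refine ⟨1 + dist (x N).tup fun _ => zeroOf (x N).str, N, by positivity, fun k hk i => ?_⟩
  obtain ⟨C, hC, f, g, hfg⟩ := Pointed.exists_dist_lt jep_matrixPathClass (hN k hk N le_rfl)
  rw [← f.dist_map, map_zeroOf]
  refine (dist_triangle _ (g ((x N).tup i)) _).trans (add_le_add ?_ ?_)
  · exact (dist_le_pi_dist (fun i => f ((x k).tup i)) (fun i => g ((x N).tup i)) i).trans hfg.le
  · rw [← map_zeroOf g, g.dist_map]
    exact dist_le_pi_dist (x N).tup (fun _ => zeroOf (x N).str) i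

lemma ccp_matrixPathClass : CCP ν.matrixPathClass := by
  refine ⟨fun n m P x hx => ?_, fun n m F x hx ε hε => ?_⟩
  · refine Metric.cauchySeq_iff.2 fun ε hε => ?_
    obtain ⟨N, hN⟩ := hx (ε / 2) (half_pos hε)
    refine ⟨N, fun k hk l hl => ?_⟩
    obtain ⟨C, hC, f, g, hfg⟩ := Pointed.exists_dist_lt jep_matrixPathClass (hN k hk l hl)
    unfold Pointed.evalPred
    rw [← f.map_pred, ← g.map_pred]
    refine (dist_predMap_le hC P _ _).trans_lt ?_
    have : dist (fun i => f ((x k).tup (Fin.castAdd m i)))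
        (fun i => g ((x l).tup (Fin.castAdd m i))) ≤ _ :=
      (dist_pi_le_iff dist_nonneg).2 fun i => dist_le_pi_dist (fun i => f ((x k).tup i))
        (fun i => g ((x l).tup i)) (Fin.castAdd m i)
    linarith
  · obtain ⟨R, N₁, hR, hbd⟩ := exists_dist_zeroOf_le hx
    obtain ⟨c, hc, hF⟩ := exists_dist_funMap_le (ν := ν) F hR
    obtain ⟨N₂, hN⟩ := hx (ε / c) (by positivity)
    refine ⟨max N₁ N₂, fun k hk l hl => ?_⟩
    obtain ⟨C, hC, f, g, hfg⟩ := Pointed.exists_dist_lt jep_matrixPathClass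
      (hN k (le_of_max_le_right hk) l (le_of_max_le_right hl))
    -- The embeddings that bring the tuples close also bring the adjoined values close.
    refine (Pointed.dist_le ((x k).adjoinFun F) ((x l).adjoinFun F) hC f g).trans_lt ?_
    rw [lt_div_iff₀' (by positivity)] at hfg
    have h0 := dist_nonneg (x := fun i => f ((x k).tup i)) (y := fun i => g ((x l).tup i))
    rw [dist_pi_lt_iff hε]
    intro i
    refine Fin.lastCases ?_ (fun i => ?_) i
    · simp only [Pointed.adjoinFun, Fin.snoc_last]
      rw [← f.map_fun, ← g.map_fun]
      refine (hF C hC _ _ (fun i => ?_) fun i => ?_).trans_lt (lt_of_le_of_lt ?_ hfg)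
      · rw [← map_zeroOf f, f.dist_map]
        exact hbd k (le_of_max_le_left hk) _
      · rw [← map_zeroOf g, g.dist_map]
        exact hbd l (le_of_max_le_left hl) _
      · refine mul_le_mul_of_nonneg_left ?_ (by linarith)
        exact (dist_pi_le_iff dist_nonneg).2 fun i => dist_le_pi_dist (fun i => f ((x k).tup i))
          (fun i => g ((x l).tup i)) (Fin.castAdd m i)
    · simp only [Pointed.adjoinFun, Fin.snoc_castSucc]
      refine lt_of_le_of_lt ?_ hfg
      refine (dist_le_pi_dist (fun i => f ((x k).tup i)) (fun i => g ((x l).tup i)) i).trans ?_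
      exact le_mul_of_one_le_left h0 hc

end SupernaturalNumber

end
noncomputable section

open MeasureTheory

/-! ### Subdividing the interval -/

/-- The affine maps of `[0,1]` onto the intervals `[j/N, (j+1)/N]`. -/
def subdivision {N : ℕ} (j : Fin N) : C(unitInterval, unitInterval) where
  toFun t := ⟨((j : ℝ) + t) / N, by
    have hN : (0 : ℝ) < N := by exact_mod_cast j.pos
    have hj : (j : ℝ) + 1 ≤ N := by exact_mod_cast j.2
    have := t.2.1
    have := t.2.2
    exact ⟨by positivity, (div_le_one hN).2 (by linarith)⟩⟩
  continuous_toFun := by fun_prop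

lemma dist_subdivision_le {N : ℕ} (j : Fin N) (s t : unitInterval) :
    dist (subdivision j s) (subdivision j t) ≤ 1 / N := by
  have hN : (0 : ℝ) < N := by exact_mod_cast j.pos
  have h : ((j : ℝ) + s) / N - ((j : ℝ) + t) / N = ((s : ℝ) - t) / N := by ring
  change dist (((j : ℝ) + s) / N) (((j : ℝ) + t) / N) ≤ 1 / N
  rw [Real.dist_eq, h, abs_div, abs_of_pos hN]
  gcongr
  rw [abs_le]
  constructor <;> linarith [s.2.1, s.2.2, t.2.1, t.2.2]

lemma integral_unitInterval (g : ℝ → ℂ) :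
    ∫ t : unitInterval, g t = ∫ x in (0 : ℝ)..1, g x := by
  rw [intervalIntegral.integral_of_le zero_le_one, ← integral_Icc_eq_integral_Ioc]
  exact unitInterval.measurePreserving_coe.integral_comp
    unitInterval.measurableEmbedding_coe g

/-- Rescaling turns each term into `N` times an integral over `[j/N, (j+1)/N]`, and these adjacent
intervals fill `[0,1]`. -/
lemma sum_integral_subdivision {N : ℕ} [NeZero N] {g : unitInterval → ℂ} (hg : Continuous g) :
    (N : ℂ)⁻¹ * ∑ j : Fin N, ∫ t, g (subdivision j t) = ∫ t, g t := by
  have hN : (0 : ℝ) < N := by exact_mod_cast Nat.pos_of_ne_zero (NeZero.ne N)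
  let G : ℝ → ℂ := fun x => g (Set.projIcc 0 1 zero_le_one x)
  have hG : Continuous G := hg.comp continuous_projIcc
  have hGg : ∀ t : unitInterval, G t = g t := fun t => by
    simp only [G, Set.projIcc_val]
  have h1 : ∀ j : Fin N, ∫ t, g (subdivision j t) =
      (N : ℂ) * ∫ x in ((j : ℕ) : ℝ) / N..((j + 1 : ℕ) : ℝ) / N, G x := by
    intro j
    have h2 : ∀ t, g (subdivision j t) = G ((t : ℝ) / N + j / N) := by
      intro t
      rw [← hGg]
      congr 1
      change ((j : ℝ) + t) / N = _
      ring
    simp only [h2]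
    rw [integral_unitInterval fun x => G (x / N + j / N),
      intervalIntegral.integral_comp_div_add _ hN.ne', Complex.real_smul]
    congr 2
    · simp
    · simp; ring
  simp only [h1]
  rw [← Finset.mul_sum, ← mul_assoc, inv_mul_cancel₀ (by exact_mod_cast NeZero.ne N), one_mul,
    Fin.sum_univ_eq_sum_range
      (fun j : ℕ => ∫ x in (j : ℝ) / N..((j + 1 : ℕ) : ℝ) / N, G x) N,
    intervalIntegral.sum_integral_adjacent_intervals
      (a := fun j : ℕ => (j : ℝ) / N) fun k _ => hG.intervalIntegrable _ _]
  simp only [Nat.cast_zero, zero_div, div_self hN.ne']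
  rw [← integral_unitInterval]
  simp only [hGg]

lemma lebesgueTrace_pathHom_subdivision {m N M : ℕ} [NeZero M] [NeZero m] [NeZero N]
    (e : Fin m × Fin N ≃ Fin M) (a : MatrixPath m) :
    (lebesgueTrace M).toCLM (pathHom e subdivision a) = (lebesgueTrace m).toCLM a := by
  rw [lebesgueTrace_pathHom, lebesgueTrace_apply]
  exact sum_integral_subdivision ((continuous_ntr m).comp a.continuous)

/-! ### Matching eigenvalues -/

/-- The piecewise linear function which is `1` on `[0, j/K]` and `0` on `[(j+1)/K, 1]`. -/
def ramp (K j : ℕ) : C(unitInterval, ℝ) := ⟨fun t => max 0 (min 1 (j + 1 - K * t)), by fun_prop⟩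

lemma ramp_apply (K j : ℕ) (t : unitInterval) :
    ramp K j t = max 0 (min 1 ((j : ℝ) + 1 - K * t)) := rfl

lemma ramp_nonneg (K j : ℕ) (t : unitInterval) : 0 ≤ ramp K j t := le_max_left _ _

lemma ramp_eq_one {K j : ℕ} {t : unitInterval} (h : (K : ℝ) * t ≤ j) : ramp K j t = 1 := by
  rw [ramp_apply, min_eq_left (by linarith), max_eq_right zero_le_one]

lemma ramp_eq_zero {K j : ℕ} {t : unitInterval} (h : (j : ℝ) + 1 ≤ K * t) : ramp K j t = 0 := by
  rw [ramp_apply, max_eq_left]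
  exact (min_le_right _ _).trans (by linarith)

lemma ramp_le_ramp_succ (K j : ℕ) (t : unitInterval) : ramp K j t ≤ ramp K (j + 1) t := by
  rw [ramp_apply, ramp_apply]
  push_cast
  gcongr
  linarith

/-- Suppose `z l` exceeds `y l` by more than `3/K`, and round `K * y l` up to `j`. By sorting,
indices `i ≥ l` have ramp `j` equal to `1` at `y i`, and indices `i ≤ l` have ramp `j + 1` equal to
`0` at `z i`. So ramp `j + 1` averages no more over `z` than ramp `j` does over `y`, contradicting
the gap `c` with two errors below `c / 2`. Of the slack `3`, one unit pays for rounding and two for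
ramp `j + 1` to vanish. -/
lemma sub_lt_of_averages_ramp {k K : ℕ} (hK : 0 < K) {y z : Fin k → unitInterval}
    (hy : Antitone y) (hz : Antitone z) {T : ℕ → ℝ} {c : ℝ}
    (hT : ∀ j < K, c ≤ T (j + 1) - T j)
    (hyT : ∀ j ≤ K, |(k : ℝ)⁻¹ * ∑ l, ramp K j (y l) - T j| < c / 2)
    (hzT : ∀ j ≤ K, |(k : ℝ)⁻¹ * ∑ l, ramp K j (z l) - T j| < c / 2) (l : Fin k) :
    (z l : ℝ) - y l ≤ 3 / K := by
  by_contra! h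
  have hK' : (0 : ℝ) < K := by exact_mod_cast hK
  rw [div_lt_iff₀ hK'] at h
  set j := ⌈(K : ℝ) * y l⌉₊ with hj
  have hj1 : (K : ℝ) * y l ≤ j := Nat.le_ceil _
  have hj2 : (j : ℝ) < K * y l + 1 := Nat.ceil_lt_add_one (mul_nonneg hK'.le (y l).2.1)
  have hzK : (K : ℝ) * z l ≤ K := mul_le_of_le_one_right hK'.le (z l).2.2
  have hjK : j < K := by
    have : (j : ℝ) < K := by nlinarith
    exact_mod_cast this
  have hle : ∀ i, ramp K (j + 1) (z i) ≤ ramp K j (y i) := by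
    intro i
    rcases le_total l i with hi | hi
    · have h1 : (y i : ℝ) ≤ y l := hy hi
      rw [ramp_eq_one ((mul_le_mul_of_nonneg_left h1 hK'.le).trans hj1), ramp_apply]
      exact max_le zero_le_one (min_le_left _ _)
    · have h1 : (z l : ℝ) ≤ z i := hz hi
      have h2 := mul_le_mul_of_nonneg_left h1 hK'.le
      rw [ramp_eq_zero]
      · exact ramp_nonneg _ _ _
      · push_cast
        nlinarith
  have havg : (k : ℝ)⁻¹ * ∑ i, ramp K (j + 1) (z i) ≤ (k : ℝ)⁻¹ * ∑ i, ramp K j (y i) :=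
    mul_le_mul_of_nonneg_left (Finset.sum_le_sum fun i _ => hle i) (by positivity)
  have h1 := (abs_lt.1 (hyT j hjK.le)).2
  have h2 := (abs_lt.1 (hzT (j + 1) hjK)).1
  have h3 := hT j hjK
  linarith

lemma TracialState.IsFaithful.re_apply_realPath_pos {n : ℕ} [NeZero n]
    {τ : TracialState (MatrixPath n)} (hτ : τ.IsFaithful) {g : C(unitInterval, ℝ)}
    (hg : ∀ t, 0 ≤ g t) {t : unitInterval} (ht : g t ≠ 0) :
    0 < (τ.toCLM (TracialState.realPath n g)).re := by
  let f : C(unitInterval, ℝ) := ⟨fun t => √(g t), by fun_prop⟩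
  have hf : f * f = g := by
    ext1 t
    exact Real.mul_self_sqrt (hg t)
  have h0 := τ.nonneg (TracialState.realPath n f)
  have hne : τ.toCLM (TracialState.realPath n g) ≠ 0 := by
    intro h
    rw [← hf, ← TracialState.star_realPath_mul_self] at h
    have h1 := congrFun (congrFun (congrArg (fun a : MatrixPath n => a t) (hτ _ h)) 0) 0
    have h2 : f t = 0 := by simpa using h1
    exact ht (by rw [← hf, ContinuousMap.mul_apply, h2, mul_zero])
  rw [TracialState.star_realPath_mul_self, hf] at h0
  exact (Complex.lt_def.1 (lt_of_le_of_ne h0 hne.symm)).1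

/-- Consecutive ramps are ordered and differ at `(i+1)/K`, so faithfulness separates their traces;
take the least of finitely many gaps. -/
lemma TracialState.IsFaithful.exists_ramp_gap {n : ℕ} [NeZero n]
    {τ : TracialState (MatrixPath n)} (hτ : τ.IsFaithful) {K : ℕ} (hK : 0 < K) :
    ∃ c > 0, ∀ j < K, c ≤ (τ.toCLM (TracialState.realPath n (ramp K (j + 1)))).re -
      (τ.toCLM (TracialState.realPath n (ramp K j))).re := by
  obtain ⟨i, hi, hmin⟩ := Finset.exists_min_image (Finset.range K)
    (fun j => (τ.toCLM (TracialState.realPath n (ramp K (j + 1)))).re -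
      (τ.toCLM (TracialState.realPath n (ramp K j))).re) ⟨0, Finset.mem_range.2 hK⟩
  refine ⟨_, ?_, fun j hj => hmin j (Finset.mem_range.2 hj)⟩
  have hK' : (0 : ℝ) < K := by exact_mod_cast hK
  have hi' : (i : ℝ) + 1 ≤ K := by exact_mod_cast Finset.mem_range.1 hi
  rw [gt_iff_lt, ← Complex.sub_re, ← map_sub, ← map_sub]
  refine hτ.re_apply_realPath_pos (t := ⟨((i : ℝ) + 1) / K, by positivity, (div_le_one hK').2 hi'⟩)
    (fun t => sub_nonneg.2 (ramp_le_ramp_succ K i t)) ?_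
  have h1 : (K : ℝ) * (((i : ℝ) + 1) / K) = i + 1 := mul_div_cancel₀ _ hK'.ne'
  rw [ContinuousMap.sub_apply, ramp_eq_one (by push_cast; exact h1.le), ramp_eq_zero h1.ge]
  norm_num

/-! ### Near amalgamation -/

lemma exists_uniform_modulus {n m : ℕ} {F : Set (MatrixPath n)} (hF : F.Finite)
    (α : MatrixPath n →⋆ₐ[ℂ] MatrixPath m) {η : ℝ} (hη : 0 < η) :
    ∃ δ > 0, ∀ a ∈ F, ∀ s t, dist s t < δ → dist (α a s) (α a t) < η := by
  induction F, hF using Set.Finite.induction_on with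
  | empty => exact ⟨1, one_pos, by simp⟩
  | @insert a F _ _ ih =>
    obtain ⟨δ, hδ, h⟩ := ih
    obtain ⟨δ', hδ', h'⟩ := Metric.uniformContinuous_iff.1
      (CompactSpace.uniformContinuous_of_continuous (α a).continuous) η hη
    refine ⟨min δ δ', lt_min hδ hδ', ?_⟩
    rintro b (rfl | hb) s t hst
    · exact h' (hst.trans_le (min_le_right _ _))
    · exact h b hb s t (hst.trans_le (min_le_left _ _))

lemma norm_unitary_conj_le {A : Type*} [CStarAlgebra A] {u : A} (hu : u ∈ unitary A) (x : A) :
    ‖u * x * star u‖ ≤ ‖x‖ :=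
  NonUnitalStarAlgHom.norm_apply_le (Unitary.conjStarAlgAut ℂ A ⟨u, hu⟩) x

/-- After a fine subdivision, a homomorphism is almost constant. -/
lemma norm_pathHom_subdivision_sub_le {m N M : ℕ} (e : Fin m × Fin N ≃ Fin M) {δ η : ℝ}
    (hη : 0 < η) (hN : 1 / (N : ℝ) < δ) {a : MatrixPath m}
    (ha : ∀ s t, dist s t < δ → dist (a s) (a t) < η) :
    ‖pathHom e subdivision a - constPath (blockHom e fun j => a (subdivision j 0))‖ ≤ η := by
  rw [ContinuousMap.norm_le _ hη.le]
  intro t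
  rw [ContinuousMap.sub_apply, pathHom_apply, ContinuousMap.const_apply, ← map_sub]
  refine norm_blockHom_le e hη.le fun j => ?_
  rw [Pi.sub_apply, ← dist_eq_norm]
  exact (ha _ _ ((dist_subdivision_le j t 0).trans_lt hN)).le

lemma lebesgueTrace_constPath {n : ℕ} [NeZero n] (A : Matrix (Fin n) (Fin n) ℂ) :
    (lebesgueTrace n).toCLM (constPath A) = ntr n A := by
  rw [lebesgueTrace_apply]
  simp

lemma ntr_unitary_conj {n : ℕ} {u : Matrix (Fin n) (Fin n) ℂ}
    (hu : u ∈ unitary (Matrix (Fin n) (Fin n) ℂ)) (A : Matrix (Fin n) (Fin n) ℂ) :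
    ntr n (u * A * star u) = ntr n A := by
  rw [mul_assoc, ntr_mul_comm, mul_assoc, Unitary.star_mul_self_of_mem hu, mul_one]

lemma ntr_blockHom_realPath {n k M : ℕ} [NeZero n] (e : Fin n × Fin k ≃ Fin M)
    (y : Fin k → unitInterval) (g : C(unitInterval, ℝ)) :
    ntr M (blockHom e fun l => TracialState.realPath n g (y l)) =
      (((k : ℝ)⁻¹ * ∑ l, g (y l) : ℝ) : ℂ) := by
  rw [ntr_blockHom]
  simp [ntr_one]

/-- Two trace-preserving homomorphisms become close after a suitable subdivision and conjugation
by a constant unitary. -/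
lemma exists_close_of_trace_preserving {n m : ℕ} [NeZero n] [NeZero m] (hnm : n ∣ m)
    {τ : TracialState (MatrixPath n)} (hτ : τ.IsFaithful)
    (α : Fin 2 → MatrixPath n →⋆ₐ[ℂ] MatrixPath m)
    (hα : ∀ i a, (lebesgueTrace m).toCLM (α i a) = τ.toCLM a)
    {G : Set (MatrixPath n)} (hG : G.Finite) {ε : ℝ} (hε : 0 < ε) :
    ∃ N₀ : ℕ, ∀ N ≥ N₀, ∀ M, ∀ _ : NeZero M, M = m * N →
      ∃ ψ₁ ψ₂ : MatrixPath m →⋆ₐ[ℂ] MatrixPath M,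
        (∀ a, (lebesgueTrace M).toCLM (ψ₁ a) = (lebesgueTrace m).toCLM a) ∧
        (∀ a, (lebesgueTrace M).toCLM (ψ₂ a) = (lebesgueTrace m).toCLM a) ∧
        ∀ a ∈ G, dist (ψ₁ (α 0 a)) (ψ₂ (α 1 a)) < ε := by
  obtain ⟨δ, hδ, hGδ⟩ := exists_uniform_modulus hG (.id ℂ _) (η := ε / 4) (by positivity)
  obtain ⟨K, hKpos, hK⟩ : ∃ K : ℕ, 0 < K ∧ 3 / (K : ℝ) < δ := by
    obtain ⟨K, hK⟩ := exists_nat_gt (3 / δ)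
    have hK0 : (0 : ℝ) < K := lt_trans (by positivity) hK
    refine ⟨K, by exact_mod_cast hK0, ?_⟩
    rw [div_lt_iff₀ hδ] at hK
    rw [div_lt_iff₀ hK0]
    linarith
  obtain ⟨c, hc, hgap⟩ := hτ.exists_ramp_gap hKpos
  -- The ramps join the test set so that the frozen representations nearly reproduce `τ` on them.
  let F : Set (MatrixPath n) :=
    G ∪ (fun j => TracialState.realPath n (ramp K j)) '' Set.Iic K
  have hF : F.Finite := hG.union ((Set.finite_Iic K).image _)
  -- Two approximation errors and one matching error, each at most `ε/4`, stay below `ε`; `c/3`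
  -- meets the strict bound `c/2` of the matching lemma.
  set η := min (ε / 4) (c / 3) with hη
  have hηpos : 0 < η := lt_min (by positivity) (by positivity)
  choose δ' hδ' hmod using fun i => exists_uniform_modulus hF (α i) hηpos
  obtain ⟨N₀, hN₀⟩ := exists_nat_gt (max (1 / δ' 0) (1 / δ' 1))
  refine ⟨N₀, ?_⟩
  rintro N hN M hM rfl
  have hNR : max (1 / δ' 0) (1 / δ' 1) < (N : ℝ) := hN₀.trans_le (by exact_mod_cast hN)
  have hNpos : (0 : ℝ) < N := lt_trans (lt_max_of_lt_left (by have := hδ' 0; positivity)) hNR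
  have : NeZero N := ⟨by rintro rfl; simp at hNpos⟩
  have hNδ : ∀ i, 1 / (N : ℝ) < δ' i := by
    intro i
    have : 1 / δ' i < N := by
      refine lt_of_le_of_lt ?_ hNR
      fin_cases i
      exacts [le_max_left _ _, le_max_right _ _]
    rw [div_lt_iff₀ (hδ' i)] at this
    rw [div_lt_iff₀ hNpos]
    linarith
  let e : Fin m × Fin N ≃ Fin (m * N) := finProdFinEquiv
  let ψ : MatrixPath m →⋆ₐ[ℂ] MatrixPath (m * N) := pathHom e subdivision
  -- Freezing each short piece at its left endpoint gives a representation by constant matrices.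
  let ρ : Fin 2 → MatrixPath n →⋆ₐ[ℂ] Matrix (Fin (m * N)) (Fin (m * N)) ℂ := fun i =>
    ((blockHom e).comp (evalPoints m fun j => subdivision j 0)).comp (α i)
  have hψρ : ∀ i, ∀ a ∈ F, ‖ψ (α i a) - constPath (ρ i a)‖ ≤ η := fun i a ha =>
    norm_pathHom_subdivision_sub_le e hηpos (hNδ i) (hmod i a ha)
  have hψtr : ∀ a, (lebesgueTrace (m * N)).toCLM (ψ a) = (lebesgueTrace m).toCLM a :=
    lebesgueTrace_pathHom_subdivision e
  have hρtr : ∀ i, ∀ a ∈ F, ‖ntr (m * N) (ρ i a) - τ.toCLM a‖ ≤ η := by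
    intro i a ha
    rw [← hα i, ← hψtr, ← lebesgueTrace_constPath, ← map_sub]
    refine (norm_lebesgueTrace_le _).trans ?_
    rw [norm_sub_rev]
    exact hψρ i a ha
  obtain ⟨k', hk'⟩ := hnm
  obtain ⟨e'⟩ : Nonempty (Fin n × Fin (k' * N) ≃ Fin (m * N)) :=
    Fintype.card_eq.1 (by simp [hk', mul_assoc])
  choose u hu y hy hρ using fun i => exists_unitary_conj_eq e' (ρ i)
  have hav : ∀ i, ∀ j ≤ K, |((k' * N : ℕ) : ℝ)⁻¹ * ∑ l, ramp K j (y i l) -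
      (τ.toCLM (TracialState.realPath n (ramp K j))).re| < c / 2 := by
    intro i j hj
    have h1 := hρtr i _ (Or.inr ⟨j, hj, rfl⟩)
    rw [hρ, ntr_unitary_conj (hu i), ntr_blockHom_realPath] at h1
    have h2 := (Complex.abs_re_le_norm _).trans h1
    rw [Complex.sub_re, Complex.ofReal_re] at h2
    have h3 : η ≤ c / 3 := min_le_right _ _
    exact h2.trans_lt (by linarith)
  have hclose : ∀ l, dist (y 0 l) (y 1 l) < δ := by
    intro l
    refine lt_of_le_of_lt ?_ hK
    rw [Subtype.dist_eq, Real.dist_eq]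
    refine abs_sub_le_iff.2 ⟨?_, ?_⟩
    · exact sub_lt_of_averages_ramp hKpos (hy 1) (hy 0) hgap (hav 1) (hav 0) l
    · exact sub_lt_of_averages_ramp hKpos (hy 0) (hy 1) hgap (hav 0) (hav 1) l
  -- Carries the diagonalizing basis of `ρ 0` to that of `ρ 1`; as a constant unitary it leaves the
  -- trace unchanged.
  let W := u 1 * star (u 0)
  have hW : W ∈ unitary (Matrix (Fin (m * N)) (Fin (m * N)) ℂ) :=
    mul_mem (hu 1) (Unitary.star_mem (hu 0))
  have hWc : constPath W ∈ unitary (MatrixPath (m * N)) :=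
    Unitary.mem_iff.2 ⟨by ext1 t; exact Unitary.star_mul_self_of_mem hW,
      by ext1 t; exact Unitary.mul_star_self_of_mem hW⟩
  refine ⟨(Unitary.conjStarAlgAut ℂ _ ⟨_, hWc⟩ : _ →⋆ₐ[ℂ] _).comp ψ, ψ, fun a => ?_, hψtr,
    fun a ha => ?_⟩
  · change (lebesgueTrace (m * N)).toCLM (constPath W * ψ a * star (constPath W)) = _
    rw [mul_assoc, TracialState.tracial, mul_assoc, Unitary.star_mul_self_of_mem hWc, mul_one,
      hψtr]
  · change dist (constPath W * ψ (α 0 a) * star (constPath W)) (ψ (α 1 a)) < ε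
    have h0 := hψρ 0 a (Or.inl ha)
    have h1 := hψρ 1 a (Or.inl ha)
    have h2 : ‖W * ρ 0 a * star W - ρ 1 a‖ ≤ ε / 4 := by
      have h3 : W * ρ 0 a * star W - ρ 1 a =
          u 1 * blockHom e' (fun l => a (y 0 l) - a (y 1 l)) * star (u 1) := by
        have h4 : (fun l => a (y 0 l) - a (y 1 l)) = (fun l => a (y 0 l)) - fun l => a (y 1 l) :=
          rfl
        rw [hρ 0, hρ 1, h4, map_sub, mul_sub, sub_mul]
        congr 1
        simp only [W, star_mul, star_star]
        calc _ = u 1 * (star (u 0) * u 0) * blockHom e' (fun l => a (y 0 l)) *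
              (star (u 0) * u 0) * star (u 1) := by simp only [mul_assoc]
          _ = _ := by rw [Unitary.star_mul_self_of_mem (hu 0), mul_one, mul_one]
      rw [h3]
      refine (norm_unitary_conj_le (hu 1) _).trans (norm_blockHom_le _ (by positivity) fun l => ?_)
      rw [← dist_eq_norm]
      exact (hGδ a ha _ _ (hclose l)).le
    have h5 : ‖constPath W * ψ (α 0 a) * star (constPath W) -
        constPath (W * ρ 0 a * star W)‖ ≤ η := by
      have h6 : constPath (W * ρ 0 a * star W) =
          constPath W * constPath (ρ 0 a) * star (constPath W) := rfl
      rw [h6, ← sub_mul, ← mul_sub]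
      exact (norm_unitary_conj_le hWc _).trans h0
    have h7 : ‖constPath (W * ρ 0 a * star W) - constPath (ρ 1 a)‖ ≤ ε / 4 := by
      rw [ContinuousMap.norm_le _ (by positivity)]
      exact fun t => h2
    have hη4 : η ≤ ε / 4 := min_le_left _ _
    rw [← dist_eq_norm] at h1 h5 h7
    rw [dist_comm] at h1
    have h8 := dist_triangle4 (constPath W * ψ (α 0 a) * star (constPath W))
      (constPath (W * ρ 0 a * star W)) (constPath (ρ 1 a)) (ψ (α 1 a))
    linarith

namespace SupernaturalNumber

open MetricStructure

variable {ν : SupernaturalNumber}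

lemma nap_matrixPathClass : NAP ν.matrixPathClass := by
  rintro _ ⟨n, hn, τ, hτ, rfl⟩ _ ⟨n₁, hn₁, τ₁, hτ₁, rfl⟩ _ ⟨n₂, hn₂, τ₂, hτ₂, rfl⟩ φ₁ φ₂ G hG ε hε
  have hm := hn.lcm (hn₁.lcm hn₂)
  -- Including `n` gives `n ∣ m` at once, without deducing `n ∣ n₁` from the existence of an
  -- embedding.
  set m := n.lcm (n₁.lcm n₂) with hmdef
  have : NeZero n := ⟨hn.1⟩
  have : NeZero m := ⟨hm.1⟩
  have hd := Nat.dvd_lcm_right n (n₁.lcm n₂)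
  obtain ⟨β₁⟩ := hτ₁.nonempty_embedding_lebesgueTrace ((Nat.dvd_lcm_left n₁ n₂).trans hd)
  obtain ⟨β₂⟩ := hτ₂.nonempty_embedding_lebesgueTrace ((Nat.dvd_lcm_right n₁ n₂).trans hd)
  obtain ⟨N₀, hN₀⟩ := exists_close_of_trace_preserving (Nat.dvd_lcm_left n (n₁.lcm n₂)) hτ
    ![(β₁.comp φ₁).toStarAlgHom, (β₂.comp φ₂).toStarAlgHom]
    (fun i a => by
      fin_cases i
      · exact (β₁.comp φ₁).trace_toStarAlgHom a
      · exact (β₂.comp φ₂).trace_toStarAlgHom a) hG hε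
  obtain ⟨N, hN, hmN⟩ := hm.exists_le_mul N₀
  have hne : NeZero (m * N) := ⟨hmN.1⟩
  obtain ⟨ψ₁, ψ₂, h₁, h₂, hclose⟩ := hN₀ N hN _ hne rfl
  exact ⟨_, hmN.lebesgueTrace_mem,
    (ψ₁.toTracialEmbedding (lebesgueTrace_isFaithful m) h₁).comp β₁,
    (ψ₂.toTracialEmbedding (lebesgueTrace_isFaithful m) h₂).comp β₂, hclose⟩

end SupernaturalNumber

end

theorem mainTheorem4 (ν : SupernaturalNumber) :
    MetricStructure.IsFraisseClass ν.matrixPathClass where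
  finitelyGenerated := by
    rintro _ ⟨n, hn, τ, hτ, rfl⟩
    exact isFinitelyGenerated_matrixPath τ
  jep := SupernaturalNumber.jep_matrixPathClass
  nap := SupernaturalNumber.nap_matrixPathClass
  wpp := SupernaturalNumber.wpp_matrixPathClass
  ccp := SupernaturalNumber.ccp_matrixPathClass
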